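/- Theorem (Cut-elimination for permissive-nominal logic). Setting. Fix a signature: sets of name sorts $\nu$, base sorts $\tau$, term-formers $f:(\alpha)\beta$ and proposition-formers $P:\alpha$, where sorts are $\alpha ::= \nu \mid \tau \mid (\alpha_1,\dots,\alpha_n) \mid [\nu]\alpha$ with $n\ge 0$. Each name sort $\nu$ has atoms $\mathbb A_\nu=\{a_{\nu,i}\mid i\in\mathbb Z\}$, and $\mathbb A=\bigcup_\nu\mathbb A_\nu$. Write $\mathbb A^{<}=\{a_{\nu,i}\mid i<0\}$ and $\mathbb A^{\ge}=\{a_{\nu,i}\mid i\geq 0\}$. A permission set is a set $(\mathbb A^{<}\cup A)\setminus B$ with $A\subseteq\mathbb A^{\ge}$ and $B\subseteq\mathbb A^{<}$ finite. A permutation $\pi$ is an element of the group of bijections of $\mathbb A$ generated by the swappings of two atoms of the same sort and, for each $\nu$, the map $\mathrm{shift}_\nu$ sending $a_{\nu,i}$ to $a_{\nu,i+1}$ and fixing all other atoms. For each sort and permission set there are countably infinitely many unknowns $X$, of sort $\mathrm{sort}(X)$ and with permission set $\mathrm{pmss}(X)$. Terms are built from atoms, tuples, $f(r)$, atom-abstractions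 $[a]r$ and moderated unknowns $\pi\cdot X$, respecting sorts; propositions are $\bot$, $\phi\Rightarrow\psi$, $P(r)$, $\forall X.\phi$. Permutations act on terms and propositions by $\pi\cdot(\pi'\cdot X)=(\pi\circ\pi')\cdot X$, $\pi\cdot[a]r=[\pi(a)]\,\pi\cdot r$, $\pi\cdot\forall X.\phi=\forall X.\,\pi\cdot\phi$, and homomorphically otherwise. The free atoms $\mathrm{fa}$ are given by $\mathrm{fa}(\pi\cdot X)=\pi(\mathrm{pmss}(X))$, $\mathrm{fa}([a]r)=\mathrm{fa}(r)\setminus\{a\}$, and as usual otherwise; $\mathrm{fV}$ denotes free unknowns. Terms and propositions are taken up to $\alpha$-equivalence: renaming of abstracted atoms and of quantified unknowns (to unknowns of the same sort and permission set), and $\pi\cdot X=\pi'\cdot X$ whenever $\pi$ and $\pi'$ agree on $\mathrm{pmss}(X)$. If $r$ has sort $\mathrm{sort}(X)$ and $\mathrm{fa}(r)\subseteq\mathrm{pmss}(X)$, then $\phi[X:=r]$ replaces each free $\pi\cdot X$ by $\pi\cdot r$, avoiding capture of unknowns (atoms may be captured). A sequent $\Phi\vdash\Psi$ is a pair of sets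 of propositions. The rules, in which a comma denotes union of sets, are: (Ax) $\Phi,\phi\vdash\pi\cdot\phi,\Psi$ for every permutation $\pi$; ($\bot$L) $\Phi,\bot\vdash\Psi$; ($\Rightarrow$L) from $\Phi\vdash\phi,\Psi$ and $\Phi,\psi\vdash\Psi$ infer $\Phi,\phi\Rightarrow\psi\vdash\Psi$; ($\Rightarrow$R) from $\Phi,\phi\vdash\psi,\Psi$ infer $\Phi\vdash\phi\Rightarrow\psi,\Psi$; ($\forall$L) from $\Phi,\phi[X:=r]\vdash\Psi$, where $r$ has sort $\mathrm{sort}(X)$ and $\mathrm{fa}(r)\subseteq\mathrm{pmss}(X)$, infer $\Phi,\forall X.\phi\vdash\Psi$; ($\forall$R) from $\Phi\vdash\phi,\Psi$, where $X\notin\mathrm{fV}(\Phi\cup\Psi)$, infer $\Phi\vdash\forall X.\phi,\Psi$; (Cut) from $\Phi\vdash\phi,\Psi$ and $\Phi,\phi\vdash\Psi$ infer $\Phi\vdash\Psi$. Claim. Let $\Phi\vdash\Psi$ be a sequent such that for every sort and every permission set there are infinitely many unknowns of that sort and permission set that are not in $\mathrm{fV}(\Phi\cup\Psi)$; every finite sequent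 is of this kind. If $\Phi\vdash\Psi$ has a derivation using these rules, including (Cut), then it has a derivation that does not use (Cut). -/

import Mathlib

/-! # Permissive-nominal logic: syntax, alpha-equivalence, substitution and sequent calculus -/

namespace PNL

universe u v w x

/-! ## Sorts and signatures -/

/-- The sort language over name sorts `N` and base sorts `B`:
`α ::= ν | τ | (α₁, …, αₙ) | [ν]α`, the empty tuple being allowed. -/
inductive Srt (N : Type u) (B : Type v) : Type (max u v)
  | name (ν : N) : Srt N B
  | base (τ : B) : Srt N B
  | tuple (n : ℕ) (s : Fin n → Srt N B) : Srt N B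
  | abs (ν : N) (α : Srt N B) : Srt N B

/-- A signature: name sorts, base sorts, term-formers `f : (dom f) cod f` and
proposition-formers `P : arity P`. -/
structure Signature where
  NameSort : Type u
  BaseSort : Type v
  TermFormer : Type w
  PropFormer : Type x
  dom : TermFormer → Srt NameSort BaseSort
  cod : TermFormer → Srt NameSort BaseSort
  arity : PropFormer → Srt NameSort BaseSort

/-- The sorts over a signature. -/
abbrev Signature.Sorts (𝒮 : Signature.{u, v, w, x}) : Type (max u v) :=
  Srt 𝒮.NameSort 𝒮.BaseSort

/-! ## Atoms, permission sets, permutations -/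

/-- Atoms. The atoms of name sort `ν` are the pairs `⟨ν, i⟩` with `i` an integer. -/
@[ext] structure Atom (N : Type u) : Type u where
  sort : N
  idx : ℤ

/-- The atoms with negative index. -/
def Atom.down (N : Type u) : Set (Atom N) := {a | a.idx < 0}

/-- The atoms with nonnegative index. -/
def Atom.up (N : Type u) : Set (Atom N) := {a | 0 ≤ a.idx}

/-- Permission sets: the sets of the form `(down ∪ A) \ B` with `A ⊆ up` and `B ⊆ down` finite. -/
@[ext] structure PermSet (N : Type u) : Type u where
  carrier : Set (Atom N)
  isPerm : ∃ A B : Set (Atom N), A.Finite ∧ B.Finite ∧ A ⊆ Atom.up N ∧ B ⊆ Atom.down N ∧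
    carrier = (Atom.down N ∪ A) \ B

open Classical in
/-- The swapping `(i j)` of the two atoms `⟨ν, i⟩`, `⟨ν, j⟩` of sort `ν`. Every bijection of
atoms considered preserves name sorts, so it is given by a family of bijections of the index
set `ℤ`, one for each name sort. -/
noncomputable def swapFun {N : Type u} (ν : N) (i j : ℤ) : N → Equiv.Perm ℤ :=
  Pi.mulSingle ν (Equiv.swap i j)

open Classical in
/-- The bijection `shift_ν`: it maps `⟨ν, i⟩` to `⟨ν, i + 1⟩` and fixes the atoms of other
sorts. -/
noncomputable def shiftFun {N : Type u} (ν : N) : N → Equiv.Perm ℤ :=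
  Pi.mulSingle ν (Equiv.addRight 1)

/-- The (level 1) permutations: the group generated by all swappings and all `shift_ν`. -/
def Perm (N : Type u) : Subgroup (N → Equiv.Perm ℤ) :=
  Subgroup.closure ({π | ∃ ν i j, π = swapFun ν i j} ∪ {π | ∃ ν, π = shiftFun ν})

/-- The swapping of two atoms of the same sort, as a permutation. -/
noncomputable def swap {N : Type u} (ν : N) (i j : ℤ) : Perm N :=
  ⟨swapFun ν i j, Subgroup.subset_closure (Or.inl ⟨ν, i, j, rfl⟩)⟩

/-- The action of a permutation on atoms. -/
def Perm.act {N : Type u} (π : Perm N) (a : Atom N) : Atom N := ⟨a.sort, π.1 a.sort a.idx⟩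

/-! ## Unknowns, raw terms and raw propositions -/

/-- Unknowns: countably infinitely many for each sort and permission set. -/
@[ext] structure Unknown (𝒮 : Signature.{u, v, w, x}) : Type (max u v) where
  sort : 𝒮.Sorts
  pmss : PermSet 𝒮.NameSort
  idx : ℕ

/-- Raw terms, indexed by their sort.
* `atom i : RawTerm (.name ν)` is the atom `⟨ν, i⟩`;
* `abs i r : RawTerm (.abs ν α)` is the abstraction `[a]r` of the atom `a = ⟨ν, i⟩` in `r`;
* `unk π S n : RawTerm α` is the suspension `π · X` where `X` is the unknown `⟨α, S, n⟩`. -/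
inductive RawTerm (𝒮 : Signature.{u, v, w, x}) : 𝒮.Sorts → Type (max u v w)
  | atom {ν : 𝒮.NameSort} (i : ℤ) : RawTerm 𝒮 (.name ν)
  | tuple {n : ℕ} {s : Fin n → 𝒮.Sorts} (r : ∀ k, RawTerm 𝒮 (s k)) : RawTerm 𝒮 (.tuple n s)
  | app (f : 𝒮.TermFormer) (r : RawTerm 𝒮 (𝒮.dom f)) : RawTerm 𝒮 (𝒮.cod f)
  | abs {ν : 𝒮.NameSort} {α : 𝒮.Sorts} (i : ℤ) (r : RawTerm 𝒮 α) : RawTerm 𝒮 (.abs ν α)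
  | unk {α : 𝒮.Sorts} (π : Perm 𝒮.NameSort) (S : PermSet 𝒮.NameSort) (n : ℕ) : RawTerm 𝒮 α

/-- Raw propositions. -/
inductive RawProp (𝒮 : Signature.{u, v, w, x}) : Type (max u v w x)
  | bot : RawProp 𝒮
  | imp (φ ψ : RawProp 𝒮) : RawProp 𝒮
  | pred (P : 𝒮.PropFormer) (r : RawTerm 𝒮 (𝒮.arity P)) : RawProp 𝒮
  | all (X : Unknown 𝒮) (φ : RawProp 𝒮) : RawProp 𝒮

variable {𝒮 : Signature.{u, v, w, x}}

/-- The raw term `id · X`. -/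
def Unknown.toRaw (X : Unknown 𝒮) : RawTerm 𝒮 X.sort := .unk 1 X.pmss X.idx

/-! ## Permutation actions -/

/-- The (level 1) permutation action on raw terms. -/
def RawTerm.perm (π : Perm 𝒮.NameSort) : ∀ {α : 𝒮.Sorts}, RawTerm 𝒮 α → RawTerm 𝒮 α
  | _, .atom (ν := ν) i => .atom (π.1 ν i)
  | _, .tuple r => .tuple (fun k => (r k).perm π)
  | _, .app f r => .app f (r.perm π)
  | _, .abs (ν := ν) i r => .abs (π.1 ν i) (r.perm π)
  | _, .unk π' S n => .unk (π * π') S n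

/-- The (level 1) permutation action on raw propositions. -/
def RawProp.perm (π : Perm 𝒮.NameSort) : RawProp 𝒮 → RawProp 𝒮
  | .bot => .bot
  | .imp φ ψ => .imp (φ.perm π) (ψ.perm π)
  | .pred P r => .pred P (r.perm π)
  | .all X φ => .all X (φ.perm π)

/-- A bijection of unknowns that preserves sorts and permission sets, given as a family of
bijections of the index set `ℕ`, one for each sort and permission set. (Only swappings are
used.) -/
abbrev Perm2 (𝒮 : Signature.{u, v, w, x}) : Type (max u v) :=
  𝒮.Sorts → PermSet 𝒮.NameSort → Equiv.Perm ℕ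

/-- The action of a level 2 permutation on unknowns. -/
abbrev Perm2.act (p : Perm2 𝒮) (X : Unknown 𝒮) : Unknown 𝒮 :=
  ⟨X.sort, X.pmss, p X.sort X.pmss X.idx⟩

open Classical in
/-- The level 2 swapping of the unknown `X` with the unknown `⟨X.sort, X.pmss, m⟩`. -/
noncomputable def swap2 (X : Unknown 𝒮) (m : ℕ) : Perm2 𝒮 :=
  fun α S => if α = X.sort ∧ S = X.pmss then Equiv.swap m X.idx else 1

/-- The (level 2) permutation action on raw terms. -/
def RawTerm.perm2 (p : Perm2 𝒮) : ∀ {α : 𝒮.Sorts}, RawTerm 𝒮 α → RawTerm 𝒮 α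
  | _, .atom i => .atom i
  | _, .tuple r => .tuple (fun k => (r k).perm2 p)
  | _, .app f r => .app f (r.perm2 p)
  | _, .abs i r => .abs i (r.perm2 p)
  | α, .unk π S n => .unk π S (p α S n)

/-- The (level 2) permutation action on raw propositions. -/
def RawProp.perm2 (p : Perm2 𝒮) : RawProp 𝒮 → RawProp 𝒮
  | .bot => .bot
  | .imp φ ψ => .imp (φ.perm2 p) (ψ.perm2 p)
  | .pred P r => .pred P (r.perm2 p)
  | .all X φ => .all (p.act X) (φ.perm2 p)

/-! ## Free atoms and free unknowns -/

/-- Free atoms of a raw term. -/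
def RawTerm.fa : ∀ {α : 𝒮.Sorts}, RawTerm 𝒮 α → Set (Atom 𝒮.NameSort)
  | _, .atom (ν := ν) i => {⟨ν, i⟩}
  | _, .tuple r => ⋃ k, (r k).fa
  | _, .app _ r => r.fa
  | _, .abs (ν := ν) i r => r.fa \ {⟨ν, i⟩}
  | _, .unk π S _ => Perm.act π '' S.carrier

/-- Free unknowns of a raw term. -/
def RawTerm.fV : ∀ {α : 𝒮.Sorts}, RawTerm 𝒮 α → Set (Unknown 𝒮)
  | _, .atom _ => ∅
  | _, .tuple r => ⋃ k, (r k).fV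
  | _, .app _ r => r.fV
  | _, .abs _ r => r.fV
  | α, .unk _ S n => {⟨α, S, n⟩}

/-- Free unknowns of a raw proposition. -/
def RawProp.fV : RawProp 𝒮 → Set (Unknown 𝒮)
  | .bot => ∅
  | .imp φ ψ => φ.fV ∪ ψ.fV
  | .pred _ r => r.fV
  | .all X φ => φ.fV \ {X}

/-! ## Alpha-equivalence -/

/-- Alpha-equivalence of raw terms: the least congruence closed under `abs_alpha` (renaming of
an abstracted atom) and `unk_alpha`. -/
inductive RawTerm.AEq : ∀ {α : 𝒮.Sorts}, RawTerm 𝒮 α → RawTerm 𝒮 α → Prop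
  | refl {α : 𝒮.Sorts} (r : RawTerm 𝒮 α) : AEq r r
  | symm {α : 𝒮.Sorts} {r s : RawTerm 𝒮 α} : AEq r s → AEq s r
  | trans {α : 𝒮.Sorts} {r s t : RawTerm 𝒮 α} : AEq r s → AEq s t → AEq r t
  | tuple {n : ℕ} {σ : Fin n → 𝒮.Sorts} {r s : ∀ k, RawTerm 𝒮 (σ k)} :
      (∀ k, AEq (r k) (s k)) → AEq (.tuple r) (.tuple s)
  | app {f : 𝒮.TermFormer} {r s : RawTerm 𝒮 (𝒮.dom f)} :
      AEq r s → AEq (.app f r) (.app f s)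
  | abs {ν : 𝒮.NameSort} {α : 𝒮.Sorts} {i : ℤ} {r s : RawTerm 𝒮 α} :
      AEq r s → AEq (.abs (ν := ν) i r) (.abs (ν := ν) i s)
  | abs_alpha {ν : 𝒮.NameSort} {α : 𝒮.Sorts} {i j : ℤ} {r s : RawTerm 𝒮 α} :
      AEq (r.perm (swap ν j i)) s → (⟨ν, j⟩ : Atom 𝒮.NameSort) ∉ r.fa →
        AEq (.abs (ν := ν) i r) (.abs (ν := ν) j s)
  | unk_alpha {α : 𝒮.Sorts} {π π' : Perm 𝒮.NameSort} {S : PermSet 𝒮.NameSort} {n : ℕ} :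
      (∀ a ∈ S.carrier, Perm.act π a = Perm.act π' a) → AEq (.unk (α := α) π S n) (.unk π' S n)

/-- Alpha-equivalence of raw propositions: the least congruence that extends alpha-equivalence of
raw terms and is closed under `all_alpha` (renaming of a quantified unknown `X` to an unknown
`Y` of the same sort and permission set). -/
inductive RawProp.AEq : RawProp 𝒮 → RawProp 𝒮 → Prop
  | refl (φ : RawProp 𝒮) : AEq φ φ
  | symm {φ ψ : RawProp 𝒮} : AEq φ ψ → AEq ψ φ
  | trans {φ ψ χ : RawProp 𝒮} : AEq φ ψ → AEq ψ χ → AEq φ χ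
  | imp {φ φ' ψ ψ' : RawProp 𝒮} : AEq φ φ' → AEq ψ ψ' → AEq (.imp φ ψ) (.imp φ' ψ')
  | pred {P : 𝒮.PropFormer} {r s : RawTerm 𝒮 (𝒮.arity P)} :
      r.AEq s → AEq (.pred P r) (.pred P s)
  | all {X : Unknown 𝒮} {φ φ' : RawProp 𝒮} : AEq φ φ' → AEq (.all X φ) (.all X φ')
  | all_alpha {X : Unknown 𝒮} {m : ℕ} {φ ψ : RawProp 𝒮} :
      AEq (φ.perm2 (swap2 X m)) ψ → (⟨X.sort, X.pmss, m⟩ : Unknown 𝒮) ∉ φ.fV →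
        AEq (.all X φ) (.all ⟨X.sort, X.pmss, m⟩ ψ)

/-! ## Substitution on raw syntax -/

/-- The action of a map `θ` from unknowns to raw terms on raw terms; it captures atoms. -/
def RawTerm.subst (θ : ∀ X : Unknown 𝒮, RawTerm 𝒮 X.sort) :
    ∀ {α : 𝒮.Sorts}, RawTerm 𝒮 α → RawTerm 𝒮 α
  | _, .atom i => .atom i
  | _, .tuple r => .tuple (fun k => (r k).subst θ)
  | _, .app f r => .app f (r.subst θ)
  | _, .abs i r => .abs i (r.subst θ)
  | α, .unk π S n => (θ ⟨α, S, n⟩).perm π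

/-- The least index `n` such that `⟨X.sort, X.pmss, n⟩` is not free in `θ Z` for any unknown `Z ≠ X`
free in `φ`. -/
noncomputable def freshIdx (X : Unknown 𝒮) (φ : RawProp 𝒮)
    (θ : ∀ X : Unknown 𝒮, RawTerm 𝒮 X.sort) : ℕ :=
  sInf {n : ℕ | ∀ Z ∈ φ.fV \ {X}, (⟨X.sort, X.pmss, n⟩ : Unknown 𝒮) ∉ (θ Z).fV}

open Classical in
/-- The map `θ` changed at `X` to have there the value `id · Y` with `Y = ⟨X.sort, X.pmss, n⟩`. -/
noncomputable def renameAt (θ : ∀ X : Unknown 𝒮, RawTerm 𝒮 X.sort) (X : Unknown 𝒮) (n : ℕ) :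
    ∀ X : Unknown 𝒮, RawTerm 𝒮 X.sort :=
  Function.update θ X (.unk 1 X.pmss n)

/-- The action of a map from unknowns to raw terms on raw propositions; it avoids capture of
unknowns by renaming the quantified unknown `X` to a fresh one. -/
noncomputable def RawProp.subst :
    RawProp 𝒮 → (∀ X : Unknown 𝒮, RawTerm 𝒮 X.sort) → RawProp 𝒮
  | .bot, _ => .bot
  | .imp φ ψ, θ => .imp (φ.subst θ) (ψ.subst θ)
  | .pred P r, θ => .pred P (r.subst θ)
  | .all X φ, θ =>
      .all ⟨X.sort, X.pmss, freshIdx X φ θ⟩ (φ.subst (renameAt θ X (freshIdx X φ θ)))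

/-! ## The operations respect alpha-equivalence -/

theorem Perm.act_mul (π π' : Perm 𝒮.NameSort) (a : Atom 𝒮.NameSort) :
    Perm.act (π * π') a = Perm.act π (Perm.act π' a) := rfl

theorem Perm.act_inj (π : Perm 𝒮.NameSort) {a b : Atom 𝒮.NameSort}
    (h : Perm.act π a = Perm.act π b) : a = b := by
  obtain ⟨ν, i⟩ := a
  obtain ⟨μ, j⟩ := b
  simp only [Perm.act, Atom.mk.injEq] at h
  obtain ⟨rfl, h⟩ := h
  simpa using h

theorem swap_act (ν : 𝒮.NameSort) (i j : ℤ) (a : Atom 𝒮.NameSort) :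
    (a = ⟨ν, i⟩ ∧ Perm.act (swap ν i j) a = ⟨ν, j⟩) ∨
    (a = ⟨ν, j⟩ ∧ Perm.act (swap ν i j) a = ⟨ν, i⟩) ∨
    (a ≠ ⟨ν, i⟩ ∧ a ≠ ⟨ν, j⟩ ∧ Perm.act (swap ν i j) a = a) := by
  classical
  obtain ⟨μ, k⟩ := a
  by_cases hμ : μ = ν
  · subst hμ
    by_cases hi : k = i
    · subst hi; simp [Perm.act, swap, swapFun]
    by_cases hj : k = j
    · subst hj; simp [Perm.act, swap, swapFun]
    simp [Perm.act, swap, swapFun, hi, hj, Equiv.swap_apply_of_ne_of_ne]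
  · simp [Perm.act, swap, swapFun, hμ]

theorem swap_conj (π : Perm 𝒮.NameSort) (ν : 𝒮.NameSort) (i j : ℤ) :
    swap ν (π.1 ν i) (π.1 ν j) * π = π * swap ν i j := by
  classical
  ext μ k
  by_cases hμ : μ = ν
  · subst hμ
    simp [swap, swapFun, Equiv.swap_apply_def]
    split_ifs <;> simp
  · simp [swap, swapFun, Pi.mulSingle_eq_of_ne hμ]

theorem RawTerm.perm_perm (π π' : Perm 𝒮.NameSort) {α : 𝒮.Sorts} (r : RawTerm 𝒮 α) :
    (r.perm π').perm π = r.perm (π * π') := by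
  induction r with
  | atom i => rfl
  | tuple r ih => simp [RawTerm.perm, ih]
  | app f r ih => simp [RawTerm.perm, ih]
  | abs i r ih => simp [RawTerm.perm, ih]
  | unk π S n => simp [RawTerm.perm, mul_assoc]

theorem RawTerm.fa_perm (π : Perm 𝒮.NameSort) {α : 𝒮.Sorts} (r : RawTerm 𝒮 α) :
    (r.perm π).fa = Perm.act π '' r.fa := by
  induction r with
  | atom i => simp [RawTerm.perm, RawTerm.fa, Perm.act]
  | tuple r ih => simp [RawTerm.perm, RawTerm.fa, ih, Set.image_iUnion]
  | app f r ih => simp [RawTerm.perm, RawTerm.fa, ih]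
  | abs i r ih =>
    rw [RawTerm.perm, RawTerm.fa, RawTerm.fa,
      Set.image_sdiff (fun _ _ h => Perm.act_inj π h), ih]
    simp [Perm.act]
  | unk π S n => rw [RawTerm.perm, RawTerm.fa, RawTerm.fa, Set.image_image]; rfl

theorem RawTerm.fV_perm (π : Perm 𝒮.NameSort) {α : 𝒮.Sorts} (r : RawTerm 𝒮 α) :
    (r.perm π).fV = r.fV := by
  induction r with
  | atom i => rfl
  | tuple r ih => simp [RawTerm.perm, RawTerm.fV, ih]
  | app f r ih => simp [RawTerm.perm, RawTerm.fV, ih]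
  | abs i r ih => simp [RawTerm.perm, RawTerm.fV, ih]
  | unk π S n => rfl

theorem RawProp.fV_perm (π : Perm 𝒮.NameSort) (φ : RawProp 𝒮) : (φ.perm π).fV = φ.fV := by
  induction φ with
  | bot => rfl
  | imp φ ψ h1 h2 => simp [RawProp.perm, RawProp.fV, h1, h2]
  | pred P r => simp [RawProp.perm, RawProp.fV, RawTerm.fV_perm]
  | all X φ h => simp [RawProp.perm, RawProp.fV, h]

theorem RawTerm.AEq.perm (π : Perm 𝒮.NameSort) {α : 𝒮.Sorts} {r s : RawTerm 𝒮 α}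
    (h : r.AEq s) : (r.perm π).AEq (s.perm π) := by
  induction h with
  | refl r => exact .refl _
  | symm _ ih => exact .symm ih
  | trans _ _ h1 h2 => exact .trans h1 h2
  | tuple _ ih => exact .tuple ih
  | app _ ih => exact .app ih
  | abs _ ih => exact .abs ih
  | @abs_alpha ν α i j r s _ hj ih =>
    refine .abs_alpha ?_ ?_
    · rw [RawTerm.perm_perm] at ih ⊢
      rwa [swap_conj]
    · rw [RawTerm.fa_perm]
      rintro ⟨a, ha, hab⟩
      have : a = ⟨ν, j⟩ := Perm.act_inj π hab
      exact hj (this ▸ ha)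
  | unk_alpha h => exact .unk_alpha (fun a ha => by rw [Perm.act_mul, Perm.act_mul, h a ha])

theorem RawTerm.AEq.fa_eq {α : 𝒮.Sorts} {r s : RawTerm 𝒮 α} (h : r.AEq s) : r.fa = s.fa := by
  induction h with
  | refl r => rfl
  | symm _ ih => exact ih.symm
  | trans _ _ h1 h2 => exact h1.trans h2
  | tuple _ ih => simp [RawTerm.fa, ih]
  | app _ ih => simpa [RawTerm.fa] using ih
  | abs _ ih => simp [RawTerm.fa, ih]
  | @abs_alpha ν α i j r s _ hj ih =>
    simp only [RawTerm.fa, ← ih, RawTerm.fa_perm]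
    ext a
    simp only [Set.mem_sdiff, Set.mem_singleton_iff, Set.mem_image]
    constructor
    · rintro ⟨ha, hai⟩
      have haj : a ≠ ⟨ν, j⟩ := fun h => hj (h ▸ ha)
      refine ⟨⟨a, ha, ?_⟩, haj⟩
      rcases swap_act ν j i a with h | h | h
      · exact absurd h.1 haj
      · exact absurd h.1 hai
      · exact h.2.2
    · rintro ⟨⟨b, hb, rfl⟩, hne⟩
      rcases swap_act ν j i b with h | h | h
      · exact absurd (h.1 ▸ hb) hj
      · exact absurd h.2 hne
      · rw [h.2.2]; exact ⟨hb, h.2.1⟩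
  | unk_alpha h => exact Set.image_congr h

theorem RawTerm.AEq.fV_eq {α : 𝒮.Sorts} {r s : RawTerm 𝒮 α} (h : r.AEq s) : r.fV = s.fV := by
  induction h with
  | refl r => rfl
  | symm _ ih => exact ih.symm
  | trans _ _ h1 h2 => exact h1.trans h2
  | tuple _ ih => simp [RawTerm.fV, ih]
  | app _ ih => simpa [RawTerm.fV] using ih
  | abs _ ih => simpa [RawTerm.fV] using ih
  | abs_alpha _ _ ih => simpa [RawTerm.fV, RawTerm.fV_perm] using ih
  | unk_alpha h => rfl

theorem RawTerm.perm_congr {α : 𝒮.Sorts} (r : RawTerm 𝒮 α) (π π' : Perm 𝒮.NameSort)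
    (h : ∀ a ∈ r.fa, Perm.act π a = Perm.act π' a) : (r.perm π).AEq (r.perm π') := by
  induction r generalizing π π' with
  | @atom ν i =>
    have := h ⟨ν, i⟩ rfl
    simp only [Perm.act, Atom.mk.injEq, true_and] at this
    simp only [RawTerm.perm, this]
    exact .refl _
  | tuple r ih => exact .tuple fun k => ih k _ _ fun a ha => h a (Set.mem_iUnion.2 ⟨k, ha⟩)
  | app f r ih => exact .app (ih _ _ h)
  | @abs ν α i r ih =>
    by_cases he : π.1 ν i = π'.1 ν i
    · simp only [RawTerm.perm, he]
      refine .abs (ih _ _ fun a ha => ?_)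
      by_cases hi : a = ⟨ν, i⟩
      · subst hi; simp [Perm.act, he]
      · exact h a ⟨ha, hi⟩
    · refine .abs_alpha ?_ ?_
      · rw [RawTerm.perm_perm]
        refine ih _ _ fun a ha => ?_
        rw [Perm.act_mul]
        rcases swap_act ν (π'.1 ν i) (π.1 ν i) (Perm.act π a) with h1 | h1 | h1
        · by_cases hi : a = ⟨ν, i⟩
          · subst hi
            simp [Perm.act, he] at h1
          · have h2 := (h a ⟨ha, hi⟩).symm.trans h1.1
            exact absurd (Perm.act_inj (b := ⟨ν, i⟩) π' h2) hi
        · have : a = ⟨ν, i⟩ := Perm.act_inj π h1.1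
          rw [h1.2, this]; rfl
        · rw [h1.2.2]
          refine h a ⟨ha, ?_⟩
          rintro rfl
          exact h1.2.1 rfl
      · rw [RawTerm.fa_perm]
        rintro ⟨a, ha, hab⟩
        by_cases hi : a = ⟨ν, i⟩
        · subst hi
          simp [Perm.act, he] at hab
        · exact hi (Perm.act_inj (b := ⟨ν, i⟩) π' ((h a ⟨ha, hi⟩).symm.trans hab))
  | unk π₀ S n =>
    refine .unk_alpha fun a ha => ?_
    rw [Perm.act_mul, Perm.act_mul]
    exact h _ ⟨a, ha, rfl⟩

theorem swap2_act (X : Unknown 𝒮) (m : ℕ) (Z : Unknown 𝒮) :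
    (Z = X ∧ Perm2.act (swap2 X m) Z = ⟨X.sort, X.pmss, m⟩) ∨
    (Z = ⟨X.sort, X.pmss, m⟩ ∧ Perm2.act (swap2 X m) Z = X) ∨
    (Z ≠ X ∧ Z ≠ ⟨X.sort, X.pmss, m⟩ ∧ Perm2.act (swap2 X m) Z = Z) := by
  obtain ⟨α, S, n⟩ := Z
  obtain ⟨β, T, k⟩ := X
  by_cases h : α = β ∧ S = T
  · obtain ⟨rfl, rfl⟩ := h
    by_cases hi : n = k
    · subst hi; simp [Perm2.act, swap2]
    by_cases hj : n = m
    · subst hj; simp [Perm2.act, swap2]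
    simp [Perm2.act, swap2, hi, hj, Equiv.swap_apply_of_ne_of_ne]
  · simp only [Perm2.act, swap2, if_neg h]
    right; right
    refine ⟨fun h' => ?_, fun h' => ?_, rfl⟩
    all_goals
      simp only [Unknown.mk.injEq] at h'
      exact h ⟨h'.1, h'.2.1⟩

theorem Perm2.act_inj (p : Perm2 𝒮) {X Y : Unknown 𝒮} (h : p.act X = p.act Y) : X = Y := by
  obtain ⟨α, S, n⟩ := X
  obtain ⟨β, T, k⟩ := Y
  simp only [Perm2.act, Unknown.mk.injEq] at h
  obtain ⟨rfl, rfl, h⟩ := h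
  simpa using h

theorem RawTerm.fV_perm2 (p : Perm2 𝒮) {α : 𝒮.Sorts} (r : RawTerm 𝒮 α) :
    (r.perm2 p).fV = p.act '' r.fV := by
  induction r with
  | atom i => simp [RawTerm.perm2, RawTerm.fV]
  | tuple r ih => simp [RawTerm.perm2, RawTerm.fV, ih, Set.image_iUnion]
  | app f r ih => simpa [RawTerm.perm2, RawTerm.fV] using ih
  | abs i r ih => simpa [RawTerm.perm2, RawTerm.fV] using ih
  | unk π S n => simp [RawTerm.perm2, RawTerm.fV, Perm2.act]

theorem RawProp.fV_perm2 (p : Perm2 𝒮) (φ : RawProp 𝒮) :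
    (φ.perm2 p).fV = p.act '' φ.fV := by
  induction φ with
  | bot => simp [RawProp.perm2, RawProp.fV]
  | imp φ ψ h1 h2 => simp [RawProp.perm2, RawProp.fV, h1, h2, Set.image_union]
  | pred P r => simp [RawProp.perm2, RawProp.fV, RawTerm.fV_perm2]
  | all X φ h =>
    rw [RawProp.perm2, RawProp.fV, RawProp.fV,
      Set.image_sdiff (fun _ _ h => Perm2.act_inj p h), h, Set.image_singleton]

theorem RawProp.AEq.perm (π : Perm 𝒮.NameSort) {φ ψ : RawProp 𝒮} (h : φ.AEq ψ) :
    (φ.perm π).AEq (ψ.perm π) := by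
  have key : ∀ {α : 𝒮.Sorts} (p : Perm2 𝒮) (r : RawTerm 𝒮 α),
      (r.perm π).perm2 p = (r.perm2 p).perm π := by
    intro α p r
    induction r with
    | atom i => rfl
    | tuple r ih => simp [RawTerm.perm, RawTerm.perm2, ih]
    | app f r ih => simp [RawTerm.perm, RawTerm.perm2, ih]
    | abs i r ih => simp [RawTerm.perm, RawTerm.perm2, ih]
    | unk π S n => rfl
  have key2 : ∀ (p : Perm2 𝒮) (φ : RawProp 𝒮), (φ.perm π).perm2 p = (φ.perm2 p).perm π := by
    intro p φ
    induction φ with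
    | bot => rfl
    | imp φ ψ h1 h2 => simp [RawProp.perm, RawProp.perm2, h1, h2]
    | pred P r => simp [RawProp.perm, RawProp.perm2, key]
    | all X φ h => simp [RawProp.perm, RawProp.perm2, h]
  induction h with
  | refl r => exact .refl _
  | symm _ ih => exact .symm ih
  | trans _ _ h1 h2 => exact .trans h1 h2
  | imp _ _ h1 h2 => exact .imp h1 h2
  | pred h => exact .pred (h.perm π)
  | all _ ih => exact .all ih
  | all_alpha _ hm ih =>
    refine .all_alpha ?_ ?_
    · rwa [key2]
    · rwa [RawProp.fV_perm]

theorem RawProp.AEq.fV_eq {φ ψ : RawProp 𝒮} (h : φ.AEq ψ) : φ.fV = ψ.fV := by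
  induction h with
  | refl r => rfl
  | symm _ ih => exact ih.symm
  | trans _ _ h1 h2 => exact h1.trans h2
  | imp _ _ h1 h2 => simp [RawProp.fV, h1, h2]
  | pred h => exact h.fV_eq
  | all _ ih => simp [RawProp.fV, ih]
  | @all_alpha X m φ ψ _ hj ih =>
    simp only [RawProp.fV, ← ih, RawProp.fV_perm2]
    ext Z
    simp only [Set.mem_sdiff, Set.mem_singleton_iff, Set.mem_image]
    constructor
    · rintro ⟨ha, hai⟩
      have haj : Z ≠ ⟨X.sort, X.pmss, m⟩ := fun h => hj (h ▸ ha)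
      refine ⟨⟨Z, ha, ?_⟩, haj⟩
      rcases swap2_act X m Z with h | h | h
      · exact absurd h.1 hai
      · exact absurd h.1 haj
      · exact h.2.2
    · rintro ⟨⟨b, hb, rfl⟩, hne⟩
      rcases swap2_act X m b with h | h | h
      · exact absurd h.2 hne
      · exact absurd (h.1 ▸ hb) hj
      · rw [h.2.2]; exact ⟨hb, h.1⟩

theorem RawTerm.subst_perm (θ : ∀ X : Unknown 𝒮, RawTerm 𝒮 X.sort) (π : Perm 𝒮.NameSort)
    {α : 𝒮.Sorts} (r : RawTerm 𝒮 α) : (r.perm π).subst θ = (r.subst θ).perm π := by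
  induction r with
  | atom i => rfl
  | tuple r ih => simp [RawTerm.perm, RawTerm.subst, ih]
  | app f r ih => simp [RawTerm.perm, RawTerm.subst, ih]
  | abs i r ih => simp [RawTerm.perm, RawTerm.subst, ih]
  | unk π S n => simp [RawTerm.perm, RawTerm.subst, RawTerm.perm_perm]

theorem RawTerm.fa_subst {θ : ∀ X : Unknown 𝒮, RawTerm 𝒮 X.sort}
    (hθ : ∀ X, (θ X).fa ⊆ X.pmss.carrier) {α : 𝒮.Sorts} (r : RawTerm 𝒮 α) :
    (r.subst θ).fa ⊆ r.fa := by
  induction r with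
  | atom i => exact subset_rfl
  | tuple r ih => exact Set.iUnion_mono ih
  | app f r ih => exact ih
  | abs i r ih => exact Set.sdiff_subset_sdiff_left ih
  | @unk α π S n =>
    rw [RawTerm.subst, RawTerm.fa_perm]
    exact Set.image_mono (hθ ⟨α, S, n⟩)

theorem RawTerm.AEq.subst {θ : ∀ X : Unknown 𝒮, RawTerm 𝒮 X.sort}
    (hθ : ∀ X, (θ X).fa ⊆ X.pmss.carrier) {α : 𝒮.Sorts} {r s : RawTerm 𝒮 α}
    (h : r.AEq s) : (r.subst θ).AEq (s.subst θ) := by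
  induction h with
  | refl r => exact .refl _
  | symm _ ih => exact .symm ih
  | trans _ _ h1 h2 => exact .trans h1 h2
  | tuple _ ih => exact .tuple ih
  | app _ ih => exact .app ih
  | abs _ ih => exact .abs ih
  | abs_alpha _ hj ih =>
    exact .abs_alpha (by rwa [RawTerm.subst_perm] at ih) fun h => hj (RawTerm.fa_subst hθ _ h)
  | @unk_alpha α π π' S n h =>
    exact RawTerm.perm_congr _ _ _ fun a ha => h a (hθ ⟨α, S, n⟩ ha)

theorem RawTerm.subst_congr {θ θ' : ∀ X : Unknown 𝒮, RawTerm 𝒮 X.sort} {α : 𝒮.Sorts}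
    (r : RawTerm 𝒮 α) (h : ∀ X ∈ r.fV, θ X = θ' X) : r.subst θ = r.subst θ' := by
  induction r with
  | atom i => rfl
  | tuple r ih =>
    simp only [RawTerm.subst]
    congr 1; funext k
    exact ih k fun X hX => h X (Set.mem_iUnion.2 ⟨k, hX⟩)
  | app f r ih => simp only [RawTerm.subst, ih h]
  | abs i r ih => simp only [RawTerm.subst, ih h]
  | @unk α π S n => simp only [RawTerm.subst, h ⟨α, S, n⟩ rfl]

theorem renameAt_self (θ : ∀ X : Unknown 𝒮, RawTerm 𝒮 X.sort) (X : Unknown 𝒮) (n : ℕ) :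
    renameAt θ X n X = .unk 1 X.pmss n := by
  classical simp [renameAt]

theorem renameAt_ne (θ : ∀ X : Unknown 𝒮, RawTerm 𝒮 X.sort) {X Z : Unknown 𝒮} (h : Z ≠ X)
    (n : ℕ) : renameAt θ X n Z = θ Z := by
  classical simp [renameAt, h]

theorem renameAt_fa {θ : ∀ X : Unknown 𝒮, RawTerm 𝒮 X.sort} (X : Unknown 𝒮) (n : ℕ)
    (hθ : ∀ X, (θ X).fa ⊆ X.pmss.carrier) (Z : Unknown 𝒮) :
    (renameAt θ X n Z).fa ⊆ Z.pmss.carrier := by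
  by_cases hZ : Z = X
  · subst hZ
    rw [renameAt_self]
    exact (Set.image_id _).subset
  · rw [renameAt_ne _ hZ]; exact hθ Z

theorem RawProp.subst_congr {θ θ' : ∀ X : Unknown 𝒮, RawTerm 𝒮 X.sort} (φ : RawProp 𝒮)
    (h : ∀ X ∈ φ.fV, θ X = θ' X) : φ.subst θ = φ.subst θ' := by
  induction φ generalizing θ θ' with
  | bot => rfl
  | imp φ ψ h1 h2 =>
    simp only [RawProp.subst, h1 fun X hX => h X (Or.inl hX), h2 fun X hX => h X (Or.inr hX)]
  | pred P r => simp only [RawProp.subst, RawTerm.subst_congr r h]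
  | all X φ ih =>
    have hf : freshIdx X φ θ = freshIdx X φ θ' := by
      simp only [freshIdx]
      congr 1; ext n
      exact forall₂_congr fun Z hZ => by rw [h Z hZ]
    simp only [RawProp.subst, ← hf]
    congr 1
    refine ih fun Z hZ => ?_
    by_cases hX : Z = X
    · subst hX; simp only [renameAt_self]
    · simp only [renameAt_ne _ hX]; exact h Z ⟨hZ, hX⟩

theorem RawTerm.subst_perm2 (p : Perm2 𝒮) (θ : ∀ X : Unknown 𝒮, RawTerm 𝒮 X.sort)
    {α : 𝒮.Sorts} (r : RawTerm 𝒮 α) : (r.perm2 p).subst θ = r.subst fun X => θ (p.act X) := by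
  induction r with
  | atom i => rfl
  | tuple r ih => simp [RawTerm.perm2, RawTerm.subst, ih]
  | app f r ih => simp [RawTerm.perm2, RawTerm.subst, ih]
  | abs i r ih => simp [RawTerm.perm2, RawTerm.subst, ih]
  | unk π S n => rfl

theorem RawProp.subst_perm2 (p : Perm2 𝒮) (θ : ∀ X : Unknown 𝒮, RawTerm 𝒮 X.sort)
    (φ : RawProp 𝒮) : (φ.perm2 p).subst θ = φ.subst fun X => θ (p.act X) := by
  induction φ generalizing θ with
  | bot => rfl
  | imp φ ψ h1 h2 => simp only [RawProp.perm2, RawProp.subst, h1, h2]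
  | pred P r => simp only [RawProp.perm2, RawProp.subst, RawTerm.subst_perm2]
  | all X φ ih =>
    have hf : freshIdx (p.act X) (φ.perm2 p) θ = freshIdx X φ fun X => θ (p.act X) := by
      simp only [freshIdx]
      congr 1; ext n
      simp only [Set.mem_ofPred_eq, RawProp.fV_perm2, Set.mem_sdiff, Set.mem_singleton_iff,
        Set.mem_image]
      constructor
      · intro h Z hZ
        exact h _ ⟨⟨Z, hZ.1, rfl⟩, fun e => hZ.2 (Perm2.act_inj p e)⟩
      · rintro h _ ⟨⟨Z, hZ, rfl⟩, hne⟩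
        exact h Z ⟨hZ, fun e => hne (e ▸ rfl)⟩
    simp only [RawProp.perm2, RawProp.subst, hf]
    congr 1
    rw [ih]
    congr 1; funext Z
    by_cases hZ : Z = X
    · subst hZ
      exact (renameAt_self θ (p.act Z) _).trans (renameAt_self _ Z _).symm
    · rw [renameAt_ne _ hZ]
      exact renameAt_ne θ (fun e => hZ (Perm2.act_inj p e)) _

theorem renameAt_swap2 (θ : ∀ X : Unknown 𝒮, RawTerm 𝒮 X.sort) (X : Unknown 𝒮) (m n : ℕ)
    {Z : Unknown 𝒮} (hZ : Z ≠ ⟨X.sort, X.pmss, m⟩) :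
    renameAt θ ⟨X.sort, X.pmss, m⟩ n (Perm2.act (swap2 X m) Z) = renameAt θ X n Z := by
  have e : ∀ (Y W : Unknown 𝒮) (hs : Y.sort = Z.sort), Y = W → ∀ t : RawTerm 𝒮 Z.sort,
      (∀ hw : W.sort = Z.sort, hw ▸ renameAt θ ⟨X.sort, X.pmss, m⟩ n W = t) →
      hs ▸ renameAt θ ⟨X.sort, X.pmss, m⟩ n Y = t := by
    rintro Y _ hs rfl t h
    exact h hs
  rcases swap2_act X m Z with h | h | h
  · obtain ⟨rfl, h⟩ := h
    rw [renameAt_self]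
    exact e (Perm2.act (swap2 Z m) Z) _ rfl h _ fun hw => renameAt_self θ ⟨Z.sort, Z.pmss, m⟩ n
  · exact absurd h.1 hZ
  · rw [renameAt_ne _ h.1]
    exact e (Perm2.act (swap2 X m) Z) _ rfl h.2.2 _ fun hw => renameAt_ne θ h.2.1 n

theorem RawProp.AEq.subst {θ : ∀ X : Unknown 𝒮, RawTerm 𝒮 X.sort}
    (hθ : ∀ X, (θ X).fa ⊆ X.pmss.carrier) {φ ψ : RawProp 𝒮} (h : φ.AEq ψ) :
    (φ.subst θ).AEq (ψ.subst θ) := by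
  induction h generalizing θ with
  | refl r => exact .refl _
  | symm _ ih => exact .symm (ih hθ)
  | trans _ _ h1 h2 => exact .trans (h1 hθ) (h2 hθ)
  | imp _ _ h1 h2 => exact .imp (h1 hθ) (h2 hθ)
  | pred h => exact .pred (h.subst hθ)
  | @all X φ φ' h ih =>
    have hf : freshIdx X φ θ = freshIdx X φ' θ := by simp only [freshIdx, h.fV_eq]
    simp only [RawProp.subst, ← hf]
    exact .all (ih (renameAt_fa X _ hθ))
  | @all_alpha X m φ ψ h hm ih =>
    have hfV := (RawProp.AEq.all_alpha h hm).fV_eq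
    have hf : freshIdx ⟨X.sort, X.pmss, m⟩ ψ θ = freshIdx X φ θ := by
      simp only [RawProp.fV] at hfV
      simp only [freshIdx, hfV]
    simp only [RawProp.subst, hf]
    have h2 := ih (renameAt_fa ⟨X.sort, X.pmss, m⟩ (freshIdx X φ θ) hθ)
    rw [RawProp.subst_perm2] at h2
    rw [RawProp.subst_congr φ fun Z hZ =>
      renameAt_swap2 θ X m (freshIdx X φ θ) (fun e : Z = _ => hm (e ▸ hZ))] at h2
    exact .all h2

/-! ## Terms and propositions -/

instance RawTerm.setoid (α : 𝒮.Sorts) : Setoid (RawTerm 𝒮 α) where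
  r := RawTerm.AEq
  iseqv := ⟨.refl, .symm, .trans⟩

instance RawProp.setoid : Setoid (RawProp 𝒮) where
  r := RawProp.AEq
  iseqv := ⟨.refl, .symm, .trans⟩

/-- Terms of sort `α`: raw terms up to alpha-equivalence. -/
def Term (𝒮 : Signature.{u, v, w, x}) (α : 𝒮.Sorts) : Type (max u v w) :=
  Quotient (RawTerm.setoid (𝒮 := 𝒮) α)

/-- Propositions: raw propositions up to alpha-equivalence. -/
def Proposition (𝒮 : Signature.{u, v, w, x}) : Type (max u v w x) :=
  Quotient (RawProp.setoid (𝒮 := 𝒮))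

/-- The term `id · X`. -/
def Unknown.toTerm (X : Unknown 𝒮) : Term 𝒮 X.sort := Quotient.mk _ (.unk 1 X.pmss X.idx)

/-- Free atoms of a term. -/
def Term.fa {α : 𝒮.Sorts} (t : Term 𝒮 α) : Set (Atom 𝒮.NameSort) :=
  Quotient.lift RawTerm.fa (fun _ _ h => RawTerm.AEq.fa_eq h) t

/-- Free unknowns of a term. -/
def Term.fV {α : 𝒮.Sorts} (t : Term 𝒮 α) : Set (Unknown 𝒮) :=
  Quotient.lift RawTerm.fV (fun _ _ h => RawTerm.AEq.fV_eq h) t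

namespace Proposition

/-- Falsity. -/
def bot : Proposition 𝒮 := Quotient.mk _ .bot

/-- Implication. -/
def imp (φ ψ : Proposition 𝒮) : Proposition 𝒮 :=
  Quotient.map₂ RawProp.imp (fun _ _ h _ _ h' => RawProp.AEq.imp h h') φ ψ

/-- The atomic proposition `P(t)`. -/
def pred (P : 𝒮.PropFormer) (t : Term 𝒮 (𝒮.arity P)) : Proposition 𝒮 :=
  Quotient.map (RawProp.pred P) (fun _ _ h => RawProp.AEq.pred h) t

/-- Universal quantification over the unknown `X`. -/
def all (X : Unknown 𝒮) (φ : Proposition 𝒮) : Proposition 𝒮 :=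
  Quotient.map (RawProp.all X) (fun _ _ h => RawProp.AEq.all h) φ

/-- The permutation action on propositions. -/
def perm (π : Perm 𝒮.NameSort) (φ : Proposition 𝒮) : Proposition 𝒮 :=
  Quotient.map (RawProp.perm π) (fun _ _ h => RawProp.AEq.perm π h) φ

/-- Free unknowns of a proposition. -/
def fV (φ : Proposition 𝒮) : Set (Unknown 𝒮) :=
  Quotient.lift RawProp.fV (fun _ _ h => RawProp.AEq.fV_eq h) φ

end Proposition

/-! ## Substitution -/

/-- (Level 2) substitutions. -/
structure Subst (𝒮 : Signature.{u, v, w, x}) where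
  toFun : ∀ X : Unknown 𝒮, Term 𝒮 X.sort
  fa_subset : ∀ X, (toFun X).fa ⊆ X.pmss.carrier
  finite : {X | toFun X ≠ X.toTerm}.Finite

/-- A choice of representatives for the values of a substitution. -/
noncomputable def Subst.rep (θ : Subst 𝒮) (X : Unknown 𝒮) : RawTerm 𝒮 X.sort :=
  Quotient.out (θ.toFun X)

theorem Subst.mk_rep (θ : Subst 𝒮) (X : Unknown 𝒮) :
    (Quotient.mk _ (θ.rep X) : Term 𝒮 X.sort) = θ.toFun X :=
  Quotient.out_eq _

theorem Subst.fa_rep (θ : Subst 𝒮) (X : Unknown 𝒮) : (θ.rep X).fa ⊆ X.pmss.carrier := by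
  have h := θ.fa_subset X
  rw [← θ.mk_rep X] at h
  exact h

/-- The capture-avoiding action of a substitution on propositions. -/
noncomputable def Proposition.subst (φ : Proposition 𝒮) (θ : Subst 𝒮) : Proposition 𝒮 :=
  Quotient.map (fun φ : RawProp 𝒮 => φ.subst θ.rep)
    (fun _ _ h => RawProp.AEq.subst θ.fa_rep h) φ

open Classical in
/-- The substitution `[X := t]`, for `t` of the sort of `X` with free atoms permitted in `X`. -/
noncomputable def Subst.single (X : Unknown 𝒮) (t : Term 𝒮 X.sort)
    (h : t.fa ⊆ X.pmss.carrier) : Subst 𝒮 where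
  toFun := Function.update (fun Y => Y.toTerm) X t
  fa_subset Y := by
    by_cases hY : Y = X
    · subst hY; rwa [Function.update_self]
    · rw [Function.update_of_ne hY]; exact (Set.image_id _).subset
  finite := (Set.finite_singleton X).subset fun Y hY => by
    by_contra hne
    exact hY (Function.update_of_ne hne _ _)

/-- The unknowns produced or consumed nontrivially by a substitution. -/
def Subst.nontriv (θ : Subst 𝒮) : Set (Unknown 𝒮) :=
  {X | θ.toFun X ≠ X.toTerm ∨ ∃ Y, Y ≠ X ∧ X ∈ (θ.toFun Y).fV}

/-! ## The equation for substitution under a quantifier -/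

theorem RawTerm.fV_finite {α : 𝒮.Sorts} (r : RawTerm 𝒮 α) : r.fV.Finite := by
  induction r with
  | atom i => exact Set.finite_empty
  | tuple r ih => exact Set.finite_iUnion ih
  | app f r ih => exact ih
  | abs i r ih => exact ih
  | unk π S n => exact Set.finite_singleton _

theorem RawProp.fV_finite (φ : RawProp 𝒮) : φ.fV.Finite := by
  induction φ with
  | bot => exact Set.finite_empty
  | imp φ ψ h1 h2 => exact h1.union h2
  | pred P r => exact r.fV_finite
  | all X φ h => exact h.sdiff

theorem freshIdx_spec (X : Unknown 𝒮) (φ : RawProp 𝒮)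
    (θ : ∀ X : Unknown 𝒮, RawTerm 𝒮 X.sort) :
    ∀ Z ∈ φ.fV \ {X}, (⟨X.sort, X.pmss, freshIdx X φ θ⟩ : Unknown 𝒮) ∉ (θ Z).fV := by
  refine Nat.sInf_mem (s := {n : ℕ | ∀ Z ∈ φ.fV \ {X},
    (⟨X.sort, X.pmss, n⟩ : Unknown 𝒮) ∉ (θ Z).fV}) ?_
  have hfin : (⋃ Z ∈ φ.fV \ {X}, (θ Z).fV).Finite :=
    φ.fV_finite.sdiff.biUnion fun Z _ => (θ Z).fV_finite
  have hinj : Function.Injective fun n : ℕ => (⟨X.sort, X.pmss, n⟩ : Unknown 𝒮) :=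
    fun a b h => (Unknown.mk.inj h).2.2
  obtain ⟨n, hn⟩ := (hfin.preimage hinj.injOn).exists_notMem
  exact ⟨n, fun Z hZ h => hn (Set.mem_biUnion hZ h)⟩

theorem RawTerm.fV_subst (θ : ∀ X : Unknown 𝒮, RawTerm 𝒮 X.sort) {α : 𝒮.Sorts}
    (r : RawTerm 𝒮 α) : ∀ Y ∈ (r.subst θ).fV, ∃ Z ∈ r.fV, Y ∈ (θ Z).fV := by
  induction r with
  | atom i => intro Y h; exact h.elim
  | tuple r ih =>
    intro Y h
    obtain ⟨k, hk⟩ := Set.mem_iUnion.1 h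
    obtain ⟨Z, hZ, hY⟩ := ih k Y hk
    exact ⟨Z, Set.mem_iUnion.2 ⟨k, hZ⟩, hY⟩
  | app f r ih => exact ih
  | abs i r ih => exact ih
  | @unk α π S n =>
    intro Y h
    rw [RawTerm.subst, RawTerm.fV_perm] at h
    exact ⟨_, rfl, h⟩

theorem RawProp.fV_subst (θ : ∀ X : Unknown 𝒮, RawTerm 𝒮 X.sort) (φ : RawProp 𝒮) :
    ∀ Y ∈ (φ.subst θ).fV, ∃ Z ∈ φ.fV, Y ∈ (θ Z).fV := by
  induction φ generalizing θ with
  | bot => intro Y h; exact h.elim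
  | imp φ ψ h1 h2 =>
    rintro Y (h | h)
    · obtain ⟨Z, hZ, hY⟩ := h1 θ Y h; exact ⟨Z, Or.inl hZ, hY⟩
    · obtain ⟨Z, hZ, hY⟩ := h2 θ Y h; exact ⟨Z, Or.inr hZ, hY⟩
  | pred P r => exact r.fV_subst θ
  | all X φ ih =>
    rintro Y ⟨h, hne⟩
    obtain ⟨Z, hZ, hY⟩ := ih _ Y h
    by_cases hX : Z = X
    · subst hX
      rw [renameAt_self] at hY
      exact absurd hY hne
    · rw [renameAt_ne _ hX] at hY
      exact ⟨Z, ⟨hZ, hX⟩, hY⟩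

theorem RawTerm.perm2_of_fix (p : Perm2 𝒮) {α : 𝒮.Sorts} (r : RawTerm 𝒮 α)
    (h : ∀ X ∈ r.fV, p.act X = X) : r.perm2 p = r := by
  induction r with
  | atom i => rfl
  | tuple r ih =>
    simp only [RawTerm.perm2]
    congr 1; funext k
    exact ih k fun X hX => h X (Set.mem_iUnion.2 ⟨k, hX⟩)
  | app f r ih => simp only [RawTerm.perm2, ih h]
  | abs i r ih => simp only [RawTerm.perm2, ih h]
  | @unk α π S n =>
    have := h ⟨α, S, n⟩ rfl
    simp only [Unknown.mk.injEq, true_and] at this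
    simp only [RawTerm.perm2, this]

theorem RawTerm.perm2_perm (p : Perm2 𝒮) (π : Perm 𝒮.NameSort) {α : 𝒮.Sorts}
    (r : RawTerm 𝒮 α) : (r.perm π).perm2 p = (r.perm2 p).perm π := by
  induction r with
  | atom i => rfl
  | tuple r ih => simp [RawTerm.perm, RawTerm.perm2, ih]
  | app f r ih => simp [RawTerm.perm, RawTerm.perm2, ih]
  | abs i r ih => simp [RawTerm.perm, RawTerm.perm2, ih]
  | unk π S n => rfl

theorem RawTerm.perm2_subst (p : Perm2 𝒮) (θ : ∀ X : Unknown 𝒮, RawTerm 𝒮 X.sort)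
    {α : 𝒮.Sorts} (r : RawTerm 𝒮 α) :
    (r.subst θ).perm2 p = r.subst fun X => (θ X).perm2 p := by
  induction r with
  | atom i => rfl
  | tuple r ih => simp [RawTerm.perm2, RawTerm.subst, ih]
  | app f r ih => simp [RawTerm.perm2, RawTerm.subst, ih]
  | abs i r ih => simp [RawTerm.perm2, RawTerm.subst, ih]
  | unk π S n => simp [RawTerm.subst, RawTerm.perm2_perm]

theorem RawProp.all_renameAt {φ : RawProp 𝒮}
    (ih : ∀ (p : Perm2 𝒮) (θ : ∀ X : Unknown 𝒮, RawTerm 𝒮 X.sort),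
      ((φ.subst θ).perm2 p).AEq (φ.subst fun X => (θ X).perm2 p))
    (θ : ∀ X : Unknown 𝒮, RawTerm 𝒮 X.sort) (X : Unknown 𝒮) (n m : ℕ)
    (hn : ∀ Z ∈ φ.fV \ {X}, (⟨X.sort, X.pmss, n⟩ : Unknown 𝒮) ∉ (θ Z).fV)
    (hm : ∀ Z ∈ φ.fV \ {X}, (⟨X.sort, X.pmss, m⟩ : Unknown 𝒮) ∉ (θ Z).fV) :
    (RawProp.all ⟨X.sort, X.pmss, n⟩ (φ.subst (renameAt θ X n))).AEq
      (RawProp.all ⟨X.sort, X.pmss, m⟩ (φ.subst (renameAt θ X m))) := by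
  by_cases hnm : n = m
  · subst hnm; exact .refl _
  refine RawProp.AEq.all_alpha (X := ⟨X.sort, X.pmss, n⟩) (m := m) ?_ ?_
  · refine .trans (ih _ _) ?_
    rw [RawProp.subst_congr (θ' := renameAt θ X m) φ]
    · exact .refl _
    · intro Z hZ
      by_cases hX : Z = X
      · subst hX
        simp only [renameAt_self, RawTerm.perm2]
        simp [swap2]
      · simp only [renameAt_ne _ hX]
        refine RawTerm.perm2_of_fix _ _ fun Y hY => ?_
        rcases swap2_act ⟨X.sort, X.pmss, n⟩ m Y with h | h | h
        · exact absurd (h.1 ▸ hY) (hn Z ⟨hZ, hX⟩)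
        · exact absurd (h.1 ▸ hY) (hm Z ⟨hZ, hX⟩)
        · exact h.2.2
  · intro h
    obtain ⟨Z, hZ, hY⟩ := RawProp.fV_subst _ _ _ h
    by_cases hX : Z = X
    · subst hX
      rw [renameAt_self] at hY
      exact hnm (Unknown.mk.inj (Set.mem_singleton_iff.1 hY)).2.2.symm
    · rw [renameAt_ne _ hX] at hY
      exact hm Z ⟨hZ, hX⟩ hY

theorem RawProp.perm2_subst (φ : RawProp 𝒮) (p : Perm2 𝒮)
    (θ : ∀ X : Unknown 𝒮, RawTerm 𝒮 X.sort) :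
    ((φ.subst θ).perm2 p).AEq (φ.subst fun X => (θ X).perm2 p) := by
  induction φ generalizing p θ with
  | bot => exact .refl _
  | imp φ ψ h1 h2 => exact .imp (h1 p θ) (h2 p θ)
  | pred P r =>
    simp only [RawProp.subst, RawProp.perm2, RawTerm.perm2_subst]
    exact .refl _
  | all X φ ih =>
    simp only [RawProp.subst, RawProp.perm2]
    have e : (fun Z => (renameAt θ X (freshIdx X φ θ) Z).perm2 p) =
        renameAt (fun Z => (θ Z).perm2 p) X (p X.sort X.pmss (freshIdx X φ θ)) := by
      funext Z
      by_cases hX : Z = X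
      · subst hX; simp only [renameAt_self, RawTerm.perm2]
      · simp only [renameAt_ne _ hX]
    have h := ih p (renameAt θ X (freshIdx X φ θ))
    rw [e] at h
    refine .trans (.all h) (RawProp.all_renameAt ih _ X _ _ ?_ (freshIdx_spec X φ _))
    intro Z hZ hmem
    rw [RawTerm.fV_perm2] at hmem
    obtain ⟨Y, hY, hYe⟩ := hmem
    have : Y = ⟨X.sort, X.pmss, freshIdx X φ θ⟩ := Perm2.act_inj p hYe
    exact freshIdx_spec X φ θ Z hZ (this ▸ hY)

theorem RawProp.subst_aeq (φ : RawProp 𝒮) {θ θ' : ∀ X : Unknown 𝒮, RawTerm 𝒮 X.sort}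
    (h : ∀ X, (θ X).AEq (θ' X)) : (φ.subst θ).AEq (φ.subst θ') := by
  induction φ generalizing θ θ' with
  | bot => exact .refl _
  | imp φ ψ h1 h2 => exact .imp (h1 h) (h2 h)
  | pred P r =>
    refine .pred ?_
    generalize 𝒮.arity P = α at r
    induction r with
    | atom i => exact .refl _
    | tuple r ih => exact .tuple ih
    | app f r ih => exact .app ih
    | abs i r ih => exact .abs ih
    | unk π S n => exact (h _).perm π
  | all X φ ih =>
    have hf : freshIdx X φ θ = freshIdx X φ θ' := by simp only [freshIdx, (h _).fV_eq]
    simp only [RawProp.subst, ← hf]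
    refine .all (ih fun Z => ?_)
    by_cases hX : Z = X
    · subst hX; simp only [renameAt_self]; exact .refl _
    · simp only [renameAt_ne _ hX]; exact h Z

/-- Substitution commutes with quantification over an unknown that it leaves alone. -/
theorem Proposition.subst_all (X : Unknown 𝒮) (φ : Proposition 𝒮) (θ : Subst 𝒮)
    (h : X ∉ θ.nontriv) : (Proposition.all X φ).subst θ = Proposition.all X (φ.subst θ) := by
  simp only [Subst.nontriv, Set.mem_ofPred_eq, not_or, not_exists, not_and, not_not] at h
  induction φ using Quotient.inductionOn with
  | h φ =>
  refine Quotient.sound ?_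
  refine RawProp.AEq.trans (RawProp.all_renameAt (fun p θ => φ.perm2_subst p θ) θ.rep X _ X.idx
    (freshIdx_spec X φ θ.rep) fun Z hZ hmem => ?_) (.all (φ.subst_aeq fun Z => ?_))
  · refine h.2 Z hZ.2 ?_
    rw [← θ.mk_rep Z]
    exact hmem
  · by_cases hX : Z = X
    · subst hX
      rw [renameAt_self]
      refine Quotient.exact ((?_ : _ = _) : Quotient.mk (RawTerm.setoid Z.sort) _ = _)
      exact (h.1.symm.trans (θ.mk_rep Z).symm)
    · rw [renameAt_ne _ hX]; exact .refl _

/-! ## Sequents and derivability -/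

/-- Free unknowns of a set of propositions. -/
def setfV (Φ : Set (Proposition 𝒮)) : Set (Unknown 𝒮) := ⋃ φ ∈ Φ, φ.fV

/-- `Derivable c Φ Ψ`: the sequent `Φ ⊢ Ψ` has a derivation from the rules below, in which the
rule `cut` may be used only if `c = true`. -/
inductive Derivable (c : Bool) : Set (Proposition 𝒮) → Set (Proposition 𝒮) → Prop
  | ax (Φ Ψ : Set (Proposition 𝒮)) (φ : Proposition 𝒮) (π : Perm 𝒮.NameSort) :
      Derivable c (insert φ Φ) (insert (φ.perm π) Ψ)
  | botL (Φ Ψ : Set (Proposition 𝒮)) : Derivable c (insert Proposition.bot Φ) Ψ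
  | impL (Φ Ψ : Set (Proposition 𝒮)) (φ ψ : Proposition 𝒮) :
      Derivable c Φ (insert φ Ψ) → Derivable c (insert ψ Φ) Ψ →
        Derivable c (insert (φ.imp ψ) Φ) Ψ
  | impR (Φ Ψ : Set (Proposition 𝒮)) (φ ψ : Proposition 𝒮) :
      Derivable c (insert φ Φ) (insert ψ Ψ) → Derivable c Φ (insert (φ.imp ψ) Ψ)
  | allL (Φ Ψ : Set (Proposition 𝒮)) (X : Unknown 𝒮) (φ : Proposition 𝒮) (t : Term 𝒮 X.sort)
      (h : t.fa ⊆ X.pmss.carrier) :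
      Derivable c (insert (φ.subst (Subst.single X t h)) Φ) Ψ →
        Derivable c (insert (Proposition.all X φ) Φ) Ψ
  | allR (Φ Ψ : Set (Proposition 𝒮)) (X : Unknown 𝒮) (φ : Proposition 𝒮) :
      X ∉ setfV (Φ ∪ Ψ) → Derivable c Φ (insert φ Ψ) →
        Derivable c Φ (insert (Proposition.all X φ) Ψ)
  | cut (Φ Ψ : Set (Proposition 𝒮)) (φ : Proposition 𝒮) : c = true →
      Derivable c Φ (insert φ Ψ) → Derivable c (insert φ Φ) Ψ → Derivable c Φ Ψ

/-- A sequent leaves a supply of fresh unknowns if, for each sort and permission set, infinitely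
many unknowns do not occur free in it. Every finite sequent does. -/
def FreshSupply (Φ Ψ : Set (Proposition 𝒮)) : Prop :=
  ∀ (α : 𝒮.Sorts) (S : PermSet 𝒮.NameSort),
    {n : ℕ | (⟨α, S, n⟩ : Unknown 𝒮) ∉ setfV (Φ ∪ Ψ)}.Infinite

theorem FreshSupply.of_finite {Φ Ψ : Set (Proposition 𝒮)} (hΦ : Φ.Finite) (hΨ : Ψ.Finite) :
    FreshSupply Φ Ψ := by
  intro α S
  have hfin : (setfV (Φ ∪ Ψ)).Finite := by
    refine (hΦ.union hΨ).biUnion fun φ _ => ?_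
    induction φ using Quotient.inductionOn with
    | h φ => exact φ.fV_finite
  have hinj : Function.Injective fun n : ℕ => (⟨α, S, n⟩ : Unknown 𝒮) :=
    fun a b h => (Unknown.mk.inj h).2.2
  exact (hfin.preimage hinj.injOn).infinite_compl

end PNL

namespace PNL

universe u v w x

variable {𝒮 : Signature.{u, v, w, x}}

/-! ## Composition of substitutions on raw syntax -/

/-! Cut is eliminated by a detour through an infinitary calculus, `Proves`, which has no
eigenvariables: a universal proposition on the right is inferred from all of its instances at once.
With no freshness side conditions, weakening holds for arbitrary sets of propositions, and no
renaming inside derivations is ever needed.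

A derivation with cuts yields, for every family `θ` of permitted terms, an infinitary proof of its
conclusion under `θ` (`Derivable.proves`). Quantifying over `θ` provides all the premises of the
infinitary right rule: the eigenvariable is sent to each term in turn, and the context does not
notice. Cuts are removed during this translation by `Proves.cut`. Conversely, an infinitary proof of
a sequent with enough fresh unknowns becomes a finitary cut-free derivation by keeping, at each
universal on the right, only the premise for a fresh unknown (`Proves.derivable`).

Cut is admissible in `Proves` by induction on the number of connectives of the cut proposition. This
number is unchanged by substitution, so instances are smaller than the quantified proposition. For a
fixed cut proposition, the proof having it on the left is traversed by structural induction, and the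
other proof enters through invertibility of the right rules (`Proves.cut_step`). Axioms identify a
proposition with its permuted copies. They are absorbed by `Proves.of_covers`: each proposition of a
sequent may be moved by its own permutation, because substitution commutes with permutations and the
shapes of permuted propositions match. -/

theorem RawTerm.perm_one {α : 𝒮.Sorts} (r : RawTerm 𝒮 α) : r.perm 1 = r := by
  induction r with
  | atom i => rfl
  | tuple r ih => simp [RawTerm.perm, ih]
  | app f r ih => simp [RawTerm.perm, ih]
  | abs i r ih => simp [RawTerm.perm, ih]
  | unk π S n => simp [RawTerm.perm]

theorem RawTerm.subst_toRaw {α : 𝒮.Sorts} (r : RawTerm 𝒮 α) : r.subst Unknown.toRaw = r := by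
  induction r with
  | atom i => rfl
  | tuple r ih => simp [RawTerm.subst, ih]
  | app f r ih => simp [RawTerm.subst, ih]
  | abs i r ih => simp [RawTerm.subst, ih]
  | unk π S n => simp [RawTerm.subst, Unknown.toRaw, RawTerm.perm]

theorem RawTerm.subst_subst (θ θ' : ∀ X : Unknown 𝒮, RawTerm 𝒮 X.sort) {α : 𝒮.Sorts}
    (r : RawTerm 𝒮 α) : (r.subst θ).subst θ' = r.subst fun X => (θ X).subst θ' := by
  induction r with
  | atom i => rfl
  | tuple r ih => simp [RawTerm.subst, ih]
  | app f r ih => simp [RawTerm.subst, ih]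
  | abs i r ih => simp [RawTerm.subst, ih]
  | unk π S n => simp [RawTerm.subst, RawTerm.subst_perm]

theorem RawTerm.mem_fV_subst (θ : ∀ X : Unknown 𝒮, RawTerm 𝒮 X.sort) {α : 𝒮.Sorts}
    (r : RawTerm 𝒮 α) {Z Y : Unknown 𝒮} (hZ : Z ∈ r.fV) (hY : Y ∈ (θ Z).fV) :
    Y ∈ (r.subst θ).fV := by
  induction r with
  | atom i => exact hZ.elim
  | tuple r ih =>
    obtain ⟨k, hk⟩ := Set.mem_iUnion.1 hZ
    exact Set.mem_iUnion.2 ⟨k, ih k hk⟩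
  | app f r ih => exact ih hZ
  | abs i r ih => exact ih hZ
  | @unk α π S n =>
    obtain rfl : Z = _ := hZ
    rwa [RawTerm.subst, RawTerm.fV_perm]

/-- Converse to `RawProp.fV_subst`. Under a quantifier the chosen index is fresh for the values at
the other free unknowns, so none of their unknowns gets bound. -/
theorem RawProp.mem_fV_subst (θ : ∀ X : Unknown 𝒮, RawTerm 𝒮 X.sort) (φ : RawProp 𝒮)
    {Z Y : Unknown 𝒮} (hZ : Z ∈ φ.fV) (hY : Y ∈ (θ Z).fV) : Y ∈ (φ.subst θ).fV := by
  induction φ generalizing θ with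
  | bot => exact hZ.elim
  | imp φ ψ h1 h2 => exact hZ.imp (fun h => h1 θ h hY) fun h => h2 θ h hY
  | pred P r => exact r.mem_fV_subst θ hZ hY
  | all X φ ih =>
    refine ⟨ih _ hZ.1 (by rwa [renameAt_ne _ hZ.2]), ?_⟩
    rintro rfl
    exact freshIdx_spec X φ θ Z hZ hY

/-- Only alpha-equivalence can hold, since the two sides choose their bound unknowns independently;
`RawProp.all_renameAt` reconciles any two fresh choices. -/
theorem RawProp.subst_subst (φ : RawProp 𝒮) (θ θ' : ∀ X : Unknown 𝒮, RawTerm 𝒮 X.sort) :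
    ((φ.subst θ).subst θ').AEq (φ.subst fun X => (θ X).subst θ') := by
  induction φ generalizing θ θ' with
  | bot => exact .refl _
  | imp φ ψ h1 h2 => exact .imp (h1 _ _) (h2 _ _)
  | pred P r =>
    simp only [RawProp.subst, RawTerm.subst_subst]
    exact .refl _
  | all X φ ih =>
    simp only [RawProp.subst]
    generalize hn : freshIdx X φ θ = n
    have hnf : ∀ Z ∈ φ.fV \ {X}, (⟨X.sort, X.pmss, n⟩ : Unknown 𝒮) ∉ (θ Z).fV :=
      hn ▸ freshIdx_spec X φ θ
    generalize hm : freshIdx ⟨X.sort, X.pmss, n⟩ (φ.subst (renameAt θ X n)) θ' = m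
    have hmf := hm ▸ freshIdx_spec ⟨X.sort, X.pmss, n⟩ (φ.subst (renameAt θ X n)) θ'
    refine .trans (.all (ih _ _)) ?_
    rw [RawProp.subst_congr (θ' := renameAt (fun Z => (θ Z).subst θ') X m) φ]
    · refine RawProp.all_renameAt (fun p θ => φ.perm2_subst p θ) _ X m _ (fun Z hZ hmem => ?_)
        (freshIdx_spec X φ _)
      -- The final index could only clash through some `W` free in `θ Z`. Such a `W` is free in the
      -- body after the first substitution, which `hmf` excludes, unless it is the renamed bound
      -- unknown, which `hnf` excludes.
      obtain ⟨W, hW, hWm⟩ := RawTerm.fV_subst _ _ _ hmem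
      refine hmf W ⟨φ.mem_fV_subst _ hZ.1 (by rwa [renameAt_ne _ hZ.2]), ?_⟩ hWm
      rintro rfl
      exact hnf Z hZ hW
    · intro Z hZ
      by_cases hX : Z = X
      · subst hX
        simp only [renameAt_self, RawTerm.subst, RawTerm.perm_one]
      · simp only [renameAt_ne _ hX]
        refine RawTerm.subst_congr _ fun W hW => renameAt_ne _ ?_ _
        rintro rfl
        exact hnf Z ⟨hZ, hX⟩ hW

theorem renameAt_toRaw (X : Unknown 𝒮) : renameAt Unknown.toRaw X X.idx = Unknown.toRaw := by
  funext Z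
  by_cases hX : Z = X
  · subst hX; rw [renameAt_self]; rfl
  · rw [renameAt_ne _ hX]

theorem RawProp.subst_toRaw (φ : RawProp 𝒮) : (φ.subst Unknown.toRaw).AEq φ := by
  induction φ with
  | bot => exact .refl _
  | imp φ ψ h1 h2 => exact .imp h1 h2
  | pred P r =>
    simp only [RawProp.subst, RawTerm.subst_toRaw]
    exact .refl _
  | all X φ ih =>
    refine .trans (RawProp.all_renameAt (fun p θ => φ.perm2_subst p θ) Unknown.toRaw X _ X.idx
      (freshIdx_spec X φ _) fun Z hZ h => hZ.2 (Eq.symm h)) ?_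
    rw [renameAt_toRaw]
    exact .all ih

theorem RawProp.all_rename (X : Unknown 𝒮) (φ : RawProp 𝒮) (n : ℕ)
    (hn : (⟨X.sort, X.pmss, n⟩ : Unknown 𝒮) ∉ (RawProp.all X φ).fV) :
    (RawProp.all ⟨X.sort, X.pmss, n⟩ (φ.subst (renameAt Unknown.toRaw X n))).AEq
      (RawProp.all X φ) := by
  refine .trans (RawProp.all_renameAt (fun p θ => φ.perm2_subst p θ) Unknown.toRaw X n X.idx
    (fun Z hZ h => ?_) fun Z hZ h => hZ.2 (Eq.symm h)) ?_
  · obtain rfl : _ = Z := h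
    exact hn hZ
  · rw [renameAt_toRaw]
    exact .all φ.subst_toRaw

/-- Holds on the nose: `freshIdx` depends on the body only through its free unknowns, which
permutations preserve, and substitution may capture atoms. -/
theorem RawProp.subst_perm (θ : ∀ X : Unknown 𝒮, RawTerm 𝒮 X.sort) (π : Perm 𝒮.NameSort)
    (φ : RawProp 𝒮) : (φ.perm π).subst θ = (φ.subst θ).perm π := by
  induction φ generalizing θ with
  | bot => rfl
  | imp φ ψ h1 h2 => simp [RawProp.perm, RawProp.subst, h1, h2]
  | pred P r => simp [RawProp.perm, RawProp.subst, RawTerm.subst_perm]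
  | all X φ ih =>
    have hf : freshIdx X (φ.perm π) θ = freshIdx X φ θ := by simp only [freshIdx, φ.fV_perm]
    simp only [RawProp.perm, RawProp.subst, hf, ih]

theorem RawProp.perm_perm (π π' : Perm 𝒮.NameSort) (φ : RawProp 𝒮) :
    (φ.perm π').perm π = φ.perm (π * π') := by
  induction φ with
  | bot => rfl
  | imp φ ψ h1 h2 => simp [RawProp.perm, h1, h2]
  | pred P r => simp [RawProp.perm, RawTerm.perm_perm]
  | all X φ ih => simp [RawProp.perm, ih]

theorem RawProp.perm_one (φ : RawProp 𝒮) : φ.perm 1 = φ := by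
  induction φ with
  | bot => rfl
  | imp φ ψ h1 h2 => simp [RawProp.perm, h1, h2]
  | pred P r => simp [RawProp.perm, RawTerm.perm_one]
  | all X φ ih => simp [RawProp.perm, ih]

/-! ## Permitted families of raw terms -/

/-- The families of raw terms whose values have only permitted free atoms. -/
abbrev RawSubst (𝒮 : Signature.{u, v, w, x}) : Type (max u v w) :=
  {θ : ∀ X : Unknown 𝒮, RawTerm 𝒮 X.sort // ∀ X, (θ X).fa ⊆ X.pmss.carrier}

/-- The identity family. -/
def RawSubst.id : RawSubst 𝒮 := ⟨Unknown.toRaw, fun _ => (Set.image_id _).subset⟩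

open Classical in
/-- The family `θ` with its value at `X` replaced by `t`. -/
noncomputable def RawSubst.update (θ : RawSubst 𝒮) (X : Unknown 𝒮) (t : RawTerm 𝒮 X.sort)
    (ht : t.fa ⊆ X.pmss.carrier) : RawSubst 𝒮 :=
  ⟨Function.update θ.1 X t, fun Y => by
    by_cases hY : Y = X
    · subst hY; rwa [Function.update_self]
    · rw [Function.update_of_ne hY]; exact θ.2 Y⟩

theorem RawSubst.update_self (θ : RawSubst 𝒮) (X : Unknown 𝒮) (t : RawTerm 𝒮 X.sort)
    (ht : t.fa ⊆ X.pmss.carrier) : (θ.update X t ht).1 X = t := by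
  simp [RawSubst.update]

theorem RawSubst.update_ne (θ : RawSubst 𝒮) {X Z : Unknown 𝒮} (hZ : Z ≠ X)
    (t : RawTerm 𝒮 X.sort) (ht : t.fa ⊆ X.pmss.carrier) : (θ.update X t ht).1 Z = θ.1 Z := by
  simp [RawSubst.update, hZ]

theorem RawSubst.update_swap2 (θ : RawSubst 𝒮) (X : Unknown 𝒮) (m : ℕ) (t : RawTerm 𝒮 X.sort)
    (ht : t.fa ⊆ X.pmss.carrier) {Z : Unknown 𝒮} (hZ : Z ≠ ⟨X.sort, X.pmss, m⟩) :
    (θ.update ⟨X.sort, X.pmss, m⟩ t ht).1 (Perm2.act (swap2 X m) Z) = (θ.update X t ht).1 Z := by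
  -- The type of the value at an unknown depends on its sort, so an equality of unknowns cannot
  -- simply be rewritten; the casts make it possible to eliminate it.
  have e : ∀ (Y W : Unknown 𝒮) (hs : Y.sort = Z.sort), Y = W → ∀ s : RawTerm 𝒮 Z.sort,
      (∀ hw : W.sort = Z.sort, hw ▸ (θ.update ⟨X.sort, X.pmss, m⟩ t ht).1 W = s) →
      hs ▸ (θ.update ⟨X.sort, X.pmss, m⟩ t ht).1 Y = s := by
    rintro Y _ hs rfl s h
    exact h hs
  rcases swap2_act X m Z with h | h | h
  · obtain ⟨rfl, h⟩ := h
    rw [RawSubst.update_self]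
    exact e (Perm2.act (swap2 Z m) Z) _ rfl h _ fun _ =>
      θ.update_self ⟨Z.sort, Z.pmss, m⟩ t ht
  · exact absurd h.1 hZ
  · rw [RawSubst.update_ne _ h.1]
    exact e (Perm2.act (swap2 X m) Z) _ rfl h.2.2 _ fun _ => RawSubst.update_ne θ h.2.1 t ht

/-- The action of a family of raw terms on propositions. -/
noncomputable def Proposition.bind (φ : Proposition 𝒮) (θ : RawSubst 𝒮) : Proposition 𝒮 :=
  Quotient.map (fun φ : RawProp 𝒮 => φ.subst θ.1) (fun _ _ h => RawProp.AEq.subst θ.2 h) φ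

theorem Proposition.bind_id (φ : Proposition 𝒮) : φ.bind RawSubst.id = φ := by
  induction φ using Quotient.inductionOn with
  | h φ => exact Quotient.sound φ.subst_toRaw

theorem Proposition.bind_congr (φ : Proposition 𝒮) {θ θ' : RawSubst 𝒮}
    (h : ∀ X ∈ φ.fV, θ.1 X = θ'.1 X) : φ.bind θ = φ.bind θ' := by
  induction φ using Quotient.inductionOn with
  | h φ => exact congrArg (Quotient.mk _) (RawProp.subst_congr φ h)

theorem Proposition.bind_perm (φ : Proposition 𝒮) (θ : RawSubst 𝒮) (π : Perm 𝒮.NameSort) :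
    (φ.perm π).bind θ = (φ.bind θ).perm π := by
  induction φ using Quotient.inductionOn with
  | h φ => exact congrArg (Quotient.mk _) (RawProp.subst_perm θ.1 π φ)

open Classical in
-- Links the substitution of the rules, which uses chosen representatives, to families with explicit
-- raw values; the two differ by alpha-equivalence of values.
theorem Proposition.subst_single_eq_bind (φ : Proposition 𝒮) (X : Unknown 𝒮)
    (t : RawTerm 𝒮 X.sort) (h : t.fa ⊆ X.pmss.carrier) :
    φ.subst (Subst.single X (Quotient.mk _ t) h) = φ.bind (RawSubst.id.update X t h) := by
  induction φ using Quotient.inductionOn with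
  | h φ =>
  refine Quotient.sound (φ.subst_aeq fun Z => Quotient.exact (s := RawTerm.setoid _) ?_)
  refine (Subst.mk_rep _ Z).trans ?_
  by_cases hZ : Z = X
  · subst hZ
    rw [RawSubst.update_self]
    exact Function.update_self (f := fun Y => Y.toTerm) Z (Quotient.mk _ t)
  · rw [RawSubst.update_ne _ hZ]
    exact Function.update_of_ne (f := fun Y => Y.toTerm) hZ (Quotient.mk _ t)

/-- The left rule for the quantifier survives `θ`: its instance at `t` becomes the instance at `t`
under `θ`. No freshness of `X` is needed, because the update overrides `θ` at `X`. -/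
theorem Proposition.bind_update_bind (φ : Proposition 𝒮) (X : Unknown 𝒮)
    (t : RawTerm 𝒮 X.sort) (h : t.fa ⊆ X.pmss.carrier) (θ : RawSubst 𝒮) :
    (φ.bind (RawSubst.id.update X t h)).bind θ =
      φ.bind (θ.update X (t.subst θ.1) ((RawTerm.fa_subst θ.2 t).trans h)) := by
  induction φ using Quotient.inductionOn with
  | h φ =>
  refine Quotient.sound (.trans (φ.subst_subst _ _) ?_)
  rw [RawProp.subst_congr φ fun Z _ => ?_]
  · exact .refl _
  by_cases hZ : Z = X
  · subst hZ; simp only [RawSubst.update_self]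
  · simp only [RawSubst.update_ne _ hZ]
    exact RawTerm.perm_one _

/-! ## The outermost shape of a proposition -/

/-- The possible outermost shapes of a proposition; a quantified proposition is described by the
set of its instances. -/
inductive Shape (P : Type*)
  | bot
  | atomic
  | imp (φ ψ : P)
  | all (I : Set P)

/-- The instances of `∀ X. φ`, after the action of `θ`. -/
def Proposition.instances (X : Unknown 𝒮) (φ : Proposition 𝒮) (θ : RawSubst 𝒮) :
    Set (Proposition 𝒮) :=
  {ψ | ∃ t h, ψ = φ.bind (θ.update X t h)}

/-- The outermost shape of a raw proposition. -/
def RawProp.shape : RawProp 𝒮 → Shape (Proposition 𝒮)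
  | .bot => .bot
  | .imp φ ψ => .imp (Quotient.mk _ φ) (Quotient.mk _ ψ)
  | .pred _ _ => .atomic
  | .all X φ => .all (Proposition.instances X (Quotient.mk _ φ) RawSubst.id)

/-- The name of a bound unknown is not determined by a proposition, but its set of instances is:
renaming the bound unknown by a swapping merely moves the place at which the family is updated. -/
theorem RawProp.AEq.shape_eq {φ ψ : RawProp 𝒮} (h : φ.AEq ψ) : φ.shape = ψ.shape := by
  induction h with
  | refl _ => rfl
  | symm _ ih => exact ih.symm
  | trans _ _ h1 h2 => exact h1.trans h2
  | imp h1 h2 _ _ => exact congrArg₂ Shape.imp (Quotient.sound h1) (Quotient.sound h2)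
  | pred _ => rfl
  | all h => simp only [RawProp.shape, (Quotient.sound h : Quotient.mk RawProp.setoid _ = _)]
  | @all_alpha X m φ ψ h hm =>
    refine congrArg Shape.all (Set.ext fun χ => exists_congr fun t => exists_congr fun ht => ?_)
    refine Eq.congr_right ?_
    rw [← (Quotient.sound h : Quotient.mk RawProp.setoid _ = _)]
    refine congrArg (Quotient.mk _) (Eq.trans ?_ (RawProp.subst_perm2 _ _ φ).symm)
    refine RawProp.subst_congr φ fun Z hZ => ?_
    exact (RawSubst.id.update_swap2 X m t ht fun e : Z = _ => hm (e ▸ hZ)).symm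

/-- The outermost shape of a proposition. -/
def Proposition.shape (φ : Proposition 𝒮) : Shape (Proposition 𝒮) :=
  Quotient.lift RawProp.shape (fun _ _ h => RawProp.AEq.shape_eq h) φ

theorem Proposition.shape_imp (φ ψ : Proposition 𝒮) : (φ.imp ψ).shape = .imp φ ψ := by
  induction φ using Quotient.inductionOn with
  | h φ =>
  induction ψ using Quotient.inductionOn with
  | h ψ => rfl

theorem Proposition.imp_bind (φ ψ : Proposition 𝒮) (θ : RawSubst 𝒮) :
    (φ.imp ψ).bind θ = (φ.bind θ).imp (ψ.bind θ) := by
  induction φ using Quotient.inductionOn with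
  | h φ =>
  induction ψ using Quotient.inductionOn with
  | h ψ => rfl

/-- Instantiating the renamed bound unknown undoes the renaming, so capture avoidance disappears
from view: what remains is `θ` updated at `X`. -/
theorem Proposition.shape_all_bind (X : Unknown 𝒮) (φ : Proposition 𝒮) (θ : RawSubst 𝒮) :
    ((Proposition.all X φ).bind θ).shape = .all (Proposition.instances X φ θ) := by
  induction φ using Quotient.inductionOn with
  | h φ =>
  refine congrArg Shape.all (Set.ext fun χ => exists_congr fun t => exists_congr fun ht => ?_)
  refine Eq.congr_right ?_
  refine Quotient.sound (.trans (RawProp.subst_subst _ _ _) ?_)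
  rw [RawProp.subst_congr φ fun Z hZ => ?_]
  · exact .refl _
  by_cases hX : Z = X
  · subst hX
    rw [renameAt_self, RawSubst.update_self, RawTerm.subst, RawTerm.perm_one]
    exact RawSubst.update_self _ ⟨Z.sort, Z.pmss, _⟩ t ht
  · rw [renameAt_ne _ hX, RawSubst.update_ne _ hX]
    refine (RawTerm.subst_congr _ fun W hW => ?_).trans (RawTerm.subst_toRaw _)
    refine RawSubst.update_ne _ ?_ _ _
    rintro rfl
    -- The chosen bound unknown does not occur in `θ Z`, so instantiating it leaves that value
    -- alone.
    exact freshIdx_spec X φ θ.1 Z ⟨hZ, hX⟩ hW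

/-! ## Orbits of propositions -/

/-- Two propositions are in the same orbit if a permutation maps the first to the second. -/
def Proposition.Orb (φ ψ : Proposition 𝒮) : Prop := ∃ π, ψ = φ.perm π

theorem Proposition.perm_perm (π π' : Perm 𝒮.NameSort) (φ : Proposition 𝒮) :
    (φ.perm π').perm π = φ.perm (π * π') := by
  induction φ using Quotient.inductionOn with
  | h φ => exact congrArg (Quotient.mk _) (φ.perm_perm π π')

theorem Proposition.Orb.refl (φ : Proposition 𝒮) : φ.Orb φ := by
  refine ⟨1, ?_⟩
  induction φ using Quotient.inductionOn with
  | h φ => exact congrArg (Quotient.mk _) φ.perm_one.symm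

theorem Proposition.Orb.trans {φ ψ χ : Proposition 𝒮} (h : φ.Orb ψ) (h' : ψ.Orb χ) :
    φ.Orb χ := by
  obtain ⟨π, rfl⟩ := h
  obtain ⟨π', rfl⟩ := h'
  exact ⟨π' * π, φ.perm_perm _ _⟩

theorem Proposition.Orb.symm {φ ψ : Proposition 𝒮} (h : φ.Orb ψ) : ψ.Orb φ := by
  obtain ⟨π, rfl⟩ := h
  refine ⟨π⁻¹, ?_⟩
  rw [Proposition.perm_perm, inv_mul_cancel]
  induction φ using Quotient.inductionOn with
  | h φ => exact congrArg (Quotient.mk _) φ.perm_one.symm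

/-- The shapes of two propositions in the same orbit. -/
inductive Shape.Orb : Shape (Proposition 𝒮) → Shape (Proposition 𝒮) → Prop
  | bot : Orb .bot .bot
  | atomic : Orb .atomic .atomic
  | imp {φ ψ φ' ψ' : Proposition 𝒮} : φ.Orb φ' → ψ.Orb ψ' → Orb (.imp φ ψ) (.imp φ' ψ')
  | all {I J : Set (Proposition 𝒮)} :
      (∀ φ ∈ I, ∃ ψ ∈ J, φ.Orb ψ) → (∀ ψ ∈ J, ∃ φ ∈ I, φ.Orb ψ) → Orb (.all I) (.all J)

/-- A permutation passes through the quantifier without touching the bound unknown and commutes with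
substitution, so instances at the same term correspond. -/
theorem Proposition.Orb.shape {φ ψ : Proposition 𝒮} (h : φ.Orb ψ) :
    Shape.Orb φ.shape ψ.shape := by
  obtain ⟨π, rfl⟩ := h
  induction φ using Quotient.inductionOn with
  | h φ =>
  cases φ with
  | bot => exact .bot
  | imp φ ψ => exact .imp ⟨π, rfl⟩ ⟨π, rfl⟩
  | pred P r => exact .atomic
  | all X φ =>
    refine .all ?_ ?_
    · rintro _ ⟨t, ht, rfl⟩
      exact ⟨_, ⟨t, ht, rfl⟩, π, Proposition.bind_perm (Quotient.mk _ φ) _ π⟩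
    · rintro _ ⟨t, ht, rfl⟩
      exact ⟨_, ⟨t, ht, rfl⟩, π, Proposition.bind_perm (Quotient.mk _ φ) _ π⟩

/-! ## Size -/

/-- The number of connectives and quantifiers of a raw proposition. -/
def RawProp.size : RawProp 𝒮 → ℕ
  | .bot => 0
  | .imp φ ψ => φ.size + ψ.size + 1
  | .pred _ _ => 0
  | .all _ φ => φ.size + 1

theorem RawProp.size_perm2 (p : Perm2 𝒮) (φ : RawProp 𝒮) : (φ.perm2 p).size = φ.size := by
  induction φ with
  | bot => rfl
  | imp φ ψ h1 h2 => simp [RawProp.perm2, RawProp.size, h1, h2]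
  | pred P r => rfl
  | all X φ h => simp [RawProp.perm2, RawProp.size, h]

theorem RawProp.size_subst (θ : ∀ X : Unknown 𝒮, RawTerm 𝒮 X.sort) (φ : RawProp 𝒮) :
    (φ.subst θ).size = φ.size := by
  induction φ generalizing θ with
  | bot => rfl
  | imp φ ψ h1 h2 => simp [RawProp.subst, RawProp.size, h1, h2]
  | pred P r => rfl
  | all X φ h => simp [RawProp.subst, RawProp.size, h]

theorem RawProp.AEq.size_eq {φ ψ : RawProp 𝒮} (h : φ.AEq ψ) : φ.size = ψ.size := by
  induction h with
  | refl _ => rfl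
  | symm _ ih => exact ih.symm
  | trans _ _ h1 h2 => exact h1.trans h2
  | imp _ _ h1 h2 => simp [RawProp.size, h1, h2]
  | pred _ => rfl
  | all _ ih => simp [RawProp.size, ih]
  | all_alpha _ _ ih => simpa [RawProp.size, RawProp.size_perm2] using ih

/-- The number of connectives and quantifiers of a proposition. -/
def Proposition.size (φ : Proposition 𝒮) : ℕ :=
  Quotient.lift RawProp.size (fun _ _ h => RawProp.AEq.size_eq h) φ

theorem Proposition.size_imp {χ φ ψ : Proposition 𝒮} (h : χ.shape = .imp φ ψ) :
    φ.size < χ.size ∧ ψ.size < χ.size := by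
  induction χ using Quotient.inductionOn with
  | h χ =>
  cases χ with
  | imp φ' ψ' =>
    cases h
    simp only [Proposition.size, Quotient.lift_mk, RawProp.size]
    omega
  | _ => cases h

/-- The measure for cut: terms do not contribute to the size, so an instance has the size of the
body, whatever term is substituted. -/
theorem Proposition.size_all {χ ψ : Proposition 𝒮} {I : Set (Proposition 𝒮)}
    (h : χ.shape = .all I) (hψ : ψ ∈ I) : ψ.size < χ.size := by
  induction χ using Quotient.inductionOn with
  | h χ =>
  cases χ with
  | all X φ =>
    cases h
    obtain ⟨t, ht, rfl⟩ := hψ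
    exact Nat.lt_succ_of_le (RawProp.size_subst _ φ).le
  | _ => cases h

/-! ## An infinitary cut-free calculus -/

/-- A cut-free calculus in which a quantified proposition on the right is inferred from all of its
instances. -/
inductive Proves : Set (Proposition 𝒮) → Set (Proposition 𝒮) → Prop
  | ax {Γ Δ : Set (Proposition 𝒮)} {φ ψ : Proposition 𝒮} :
      φ ∈ Γ → ψ ∈ Δ → φ.Orb ψ → Proves Γ Δ
  | botL {Γ Δ : Set (Proposition 𝒮)} {χ : Proposition 𝒮} : χ ∈ Γ → χ.shape = .bot → Proves Γ Δ
  | impL {Γ Δ : Set (Proposition 𝒮)} {χ φ ψ : Proposition 𝒮} : χ ∈ Γ → χ.shape = .imp φ ψ →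
      Proves Γ (insert φ Δ) → Proves (insert ψ Γ) Δ → Proves Γ Δ
  | impR {Γ Δ : Set (Proposition 𝒮)} {χ φ ψ : Proposition 𝒮} : χ ∈ Δ → χ.shape = .imp φ ψ →
      Proves (insert φ Γ) (insert ψ Δ) → Proves Γ Δ
  | allL {Γ Δ : Set (Proposition 𝒮)} {χ φ : Proposition 𝒮} {I : Set (Proposition 𝒮)} :
      χ ∈ Γ → χ.shape = .all I → φ ∈ I → Proves (insert φ Γ) Δ → Proves Γ Δ
  | allR {Γ Δ : Set (Proposition 𝒮)} {χ : Proposition 𝒮} {I : Set (Proposition 𝒮)} :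
      χ ∈ Δ → χ.shape = .all I → (∀ φ ∈ I, Proves Γ (insert φ Δ)) → Proves Γ Δ

/-! ### Weakening up to permutation -/

/-- Every element of `Γ` has an element of its orbit in `Γ'`. -/
def Covers (Γ Γ' : Set (Proposition 𝒮)) : Prop := ∀ φ ∈ Γ, ∃ ψ ∈ Γ', φ.Orb ψ

theorem Covers.of_subset {Γ Γ' : Set (Proposition 𝒮)} (h : Γ ⊆ Γ') : Covers Γ Γ' :=
  fun φ hφ => ⟨φ, h hφ, .refl φ⟩

theorem Covers.insert {Γ Γ' : Set (Proposition 𝒮)} (h : Covers Γ Γ') {φ ψ : Proposition 𝒮}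
    (hφ : φ.Orb ψ) : Covers (insert φ Γ) (insert ψ Γ') := by
  rintro χ (rfl | hχ)
  · exact ⟨ψ, Set.mem_insert _ _, hφ⟩
  · obtain ⟨χ', hχ', ho⟩ := h χ hχ
    exact ⟨χ', Set.mem_insert_of_mem _ hχ', ho⟩

/-- Rules other than the axiom see a principal proposition only through its shape, and orbits
respect shapes; axioms compose with the permutations. Different propositions may be moved by
different permutations. -/
theorem Proves.of_covers {Γ Δ Γ' Δ' : Set (Proposition 𝒮)} (h : Proves Γ Δ) (hΓ : Covers Γ Γ')
    (hΔ : Covers Δ Δ') : Proves Γ' Δ' := by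
  induction h generalizing Γ' Δ' with
  | ax hφ hψ ho =>
    obtain ⟨φ', hφ', h1⟩ := hΓ _ hφ
    obtain ⟨ψ', hψ', h2⟩ := hΔ _ hψ
    exact .ax hφ' hψ' (h1.symm.trans (ho.trans h2))
  | botL hχ hs =>
    obtain ⟨χ', hχ', ho⟩ := hΓ _ hχ
    have ho := ho.shape
    rw [hs] at ho
    generalize hs' : χ'.shape = s' at ho
    cases ho
    exact .botL hχ' hs'
  | impL hχ hs _ _ ih1 ih2 =>
    obtain ⟨χ', hχ', ho⟩ := hΓ _ hχ
    have ho := ho.shape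
    rw [hs] at ho
    generalize hs' : χ'.shape = s' at ho
    cases ho with
    | imp h1 h2 => exact .impL hχ' hs' (ih1 hΓ (hΔ.insert h1)) (ih2 (hΓ.insert h2) hΔ)
  | impR hχ hs _ ih =>
    obtain ⟨χ', hχ', ho⟩ := hΔ _ hχ
    have ho := ho.shape
    rw [hs] at ho
    generalize hs' : χ'.shape = s' at ho
    cases ho with
    | imp h1 h2 => exact .impR hχ' hs' (ih (hΓ.insert h1) (hΔ.insert h2))
  | allL hχ hs hφ _ ih =>
    obtain ⟨χ', hχ', ho⟩ := hΓ _ hχ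
    have ho := ho.shape
    rw [hs] at ho
    generalize hs' : χ'.shape = s' at ho
    cases ho with
    | all h1 h2 =>
      obtain ⟨φ', hφ', ho⟩ := h1 _ hφ
      exact .allL hχ' hs' hφ' (ih (hΓ.insert ho) hΔ)
  | allR hχ hs _ ih =>
    obtain ⟨χ', hχ', ho⟩ := hΔ _ hχ
    have ho := ho.shape
    rw [hs] at ho
    generalize hs' : χ'.shape = s' at ho
    cases ho with
    | all h1 h2 =>
      refine .allR hχ' hs' fun φ' hφ' => ?_
      -- A premise is owed for each instance of the new proposition, so the backward half of the
      -- matching of instances is used here; the left rule uses the forward half.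
      obtain ⟨φ, hφ, ho⟩ := h2 _ hφ'
      exact ih φ hφ hΓ (hΔ.insert ho)

theorem Proves.mono {Γ Δ Γ' Δ' : Set (Proposition 𝒮)} (h : Proves Γ Δ) (hΓ : Γ ⊆ Γ')
    (hΔ : Δ ⊆ Δ') : Proves Γ' Δ' :=
  h.of_covers (.of_subset hΓ) (.of_subset hΔ)

/-! ### Invertibility of the right rules -/

/-- What a proof of a sequent with a proposition of the given shape on the right gives on
inverting the right rule for that shape. -/
def Shape.RightInverse (Γ Δ : Set (Proposition 𝒮)) : Shape (Proposition 𝒮) → Prop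
  | .bot => Proves Γ Δ
  | .atomic => True
  | .imp φ ψ => Proves (insert φ Γ) (insert ψ Δ)
  | .all I => ∀ φ ∈ I, Proves Γ (insert φ Δ)

/-- Puts the inversions in a single form, so that one induction proves them all: the target sequent
extends the context and contains the components of the inverted proposition, or one given instance
of it. Nothing is asked of atomic shapes. -/
theorem Shape.RightInverse.intro {Γ Δ : Set (Proposition 𝒮)} {s : Shape (Proposition 𝒮)}
    (h : ∀ Γ' Δ', Γ ⊆ Γ' → Δ ⊆ Δ' → s ≠ .atomic →
      (∀ φ ψ, s = .imp φ ψ → φ ∈ Γ' ∧ ψ ∈ Δ') → (∀ I, s = .all I → ∃ φ ∈ I, φ ∈ Δ') →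
        Proves Γ' Δ') : s.RightInverse Γ Δ := by
  cases s with
  | bot =>
    exact h _ _ subset_rfl subset_rfl (fun e => nomatch e) (fun _ _ e => nomatch e)
      fun _ e => nomatch e
  | atomic => trivial
  | imp φ ψ =>
    refine h _ _ (Set.subset_insert _ _) (Set.subset_insert _ _) (fun e => nomatch e) ?_
      fun _ e => nomatch e
    rintro _ _ ⟨⟩
    exact ⟨Set.mem_insert _ _, Set.mem_insert _ _⟩
  | all I =>
    intro φ hφ
    refine h _ _ subset_rfl (Set.subset_insert _ _) (fun e => nomatch e)
      (fun _ _ e => nomatch e) ?_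
    rintro _ ⟨⟩
    exact ⟨φ, hφ, Set.mem_insert _ _⟩

theorem insert_subset_insert_insert {α : Type*} {s t : Set α} {a : α} (h : s ⊆ insert a t)
    (b : α) : insert b s ⊆ insert a (insert b t) := by
  rw [Set.insert_comm]
  exact Set.insert_subset_insert h

theorem Proves.of_rightInverse {Γ₀ Δ₀ Γ Δ : Set (Proposition 𝒮)} {χ : Proposition 𝒮}
    (h : Proves Γ₀ Δ₀) (hΓ : Γ₀ ⊆ Γ) (hΔ : Δ₀ ⊆ insert χ Δ) (hχ : χ.shape ≠ .atomic)
    (himp : ∀ φ ψ, χ.shape = .imp φ ψ → φ ∈ Γ ∧ ψ ∈ Δ)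
    (hall : ∀ I, χ.shape = .all I → ∃ φ ∈ I, φ ∈ Δ) : Proves Γ Δ := by
  induction h generalizing Γ Δ with
  | @ax _ _ φ ψ hφ hψ ho =>
    rcases hΔ hψ with rfl | hψ
    -- The inverted proposition is the right side of an axiom. The axiom is expanded by one
    -- connective: the matching proposition on the left is decomposed, and its components meet those
    -- already present.
    · have ho' := ho.shape
      generalize hs : φ.shape = s at ho'
      generalize hs' : ψ.shape = s' at ho'
      cases ho' with
      | bot => exact .botL (hΓ hφ) hs
      | atomic => exact absurd hs' hχ
      | imp h1 h2 =>
        obtain ⟨ha, hb⟩ := himp _ _ hs'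
        exact .impL (hΓ hφ) hs (.ax ha (Set.mem_insert _ _) h1.symm)
          (.ax (Set.mem_insert _ _) hb h2)
      | all h1 h2 =>
        obtain ⟨ψ', hI, hψ'⟩ := hall _ hs'
        obtain ⟨φ', hφ', ho'⟩ := h2 _ hI
        exact .allL (hΓ hφ) hs hφ' (.ax (Set.mem_insert _ _) hψ' ho')
    · exact .ax (hΓ hφ) hψ ho
  | botL h hs => exact .botL (hΓ h) hs
  | impL h hs _ _ ih1 ih2 =>
    refine .impL (hΓ h) hs (ih1 hΓ (insert_subset_insert_insert hΔ _) ?_ ?_)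
      (ih2 (Set.insert_subset_insert hΓ) hΔ ?_ hall)
    · exact fun φ ψ e => (himp φ ψ e).imp_right (Set.mem_insert_of_mem _)
    · exact fun I e => (hall I e).imp fun _ => And.imp_right (Set.mem_insert_of_mem _)
    · exact fun φ ψ e => (himp φ ψ e).imp_left (Set.mem_insert_of_mem _)
  | impR h hs _ ih =>
    rcases hΔ h with rfl | h
    -- The rule introduces the inverted proposition itself. Both components are already in the
    -- target sequent, so the premise gives the result and the rule is dropped.
    · obtain ⟨ha, hb⟩ := himp _ _ hs
      exact ih (Set.insert_subset ha hΓ)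
        (Set.insert_subset (Set.mem_insert_of_mem _ hb) hΔ) himp hall
    · refine .impR h hs (ih (Set.insert_subset_insert hΓ) (insert_subset_insert_insert hΔ _)
        ?_ ?_)
      · exact fun φ ψ e => (himp φ ψ e).imp (Set.mem_insert_of_mem _) (Set.mem_insert_of_mem _)
      · exact fun I e => (hall I e).imp fun _ => And.imp_right (Set.mem_insert_of_mem _)
  | allL h hs hφ _ ih =>
    exact .allL (hΓ h) hs hφ (ih (Set.insert_subset_insert hΓ) hΔ
      (fun φ ψ e => (himp φ ψ e).imp_left (Set.mem_insert_of_mem _)) hall)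
  | allR h hs _ ih =>
    rcases hΔ h with rfl | h
    · obtain ⟨φ, hI, hφ⟩ := hall _ hs
      exact ih φ hI hΓ (Set.insert_subset (Set.mem_insert_of_mem _ hφ) hΔ) himp hall
    · refine .allR h hs fun φ hφ => ih φ hφ hΓ (insert_subset_insert_insert hΔ _) ?_ ?_
      · exact fun φ ψ e => (himp φ ψ e).imp_right (Set.mem_insert_of_mem _)
      · exact fun I e => (hall I e).imp fun _ => And.imp_right (Set.mem_insert_of_mem _)

/-- The right rules are invertible. -/
theorem Proves.rightInverse {Γ Δ : Set (Proposition 𝒮)} {χ : Proposition 𝒮}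
    (h : Proves Γ (insert χ Δ)) : χ.shape.RightInverse Γ Δ :=
  .intro fun _ _ hΓ hΔ => h.of_rightInverse hΓ (Set.insert_subset_insert hΔ)

/-! ### Admissibility of cut -/

/-- Replaces a proposition on the left, provided that it is provable on the right and that cuts
on smaller propositions are admissible. -/
theorem Proves.cut_step {Γ Δ Γ₀ Δ₀ Γ' : Set (Proposition 𝒮)} {χ : Proposition 𝒮}
    (cut : ∀ φ : Proposition 𝒮, φ.size < χ.size → ∀ Γ Δ, Proves Γ (insert φ Δ) →
      Proves (insert φ Γ) Δ → Proves Γ Δ)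
    (hχ : Proves Γ (insert χ Δ)) (h : Proves Γ₀ Δ₀) (h₀ : Γ₀ ⊆ insert χ Γ') (hΓ : Γ ⊆ Γ')
    (hΔ : Δ ⊆ Δ₀) : Proves Γ' Δ₀ := by
  have inv := hχ.rightInverse
  induction h generalizing Γ' with
  | ax hφ hψ ho =>
    rcases h₀ hφ with rfl | hφ
    -- The axiom puts a permuted copy of the cut proposition on the right, so the proof of the cut
    -- proposition applies once it is moved to that copy.
    · refine hχ.of_covers (.of_subset hΓ) ?_
      rintro φ (rfl | hφ)
      · exact ⟨_, hψ, ho⟩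
      · exact ⟨φ, hΔ hφ, .refl φ⟩
    · exact .ax hφ hψ ho
  | botL h hs =>
    rcases h₀ h with rfl | h
    · rw [hs] at inv
      exact Proves.mono inv hΓ hΔ
    · exact .botL h hs
  | impL h hs _ _ ih1 ih2 =>
    -- Principal propositions persist in premises, so the cut proposition is first eliminated from
    -- both premises, whether or not it is principal.
    have h1 := ih1 h₀ hΓ (hΔ.trans (Set.subset_insert _ _))
    have h2 := ih2 (insert_subset_insert_insert h₀ _) (hΓ.trans (Set.subset_insert _ _)) hΔ
    rcases h₀ h with rfl | h
    · rw [hs] at inv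
      have hsize := Proposition.size_imp hs
      -- The inverted proof derives the conclusion of the implication from its hypothesis. An inner
      -- cut removes the hypothesis against the first premise, an outer cut removes the conclusion
      -- against the second.
      refine cut _ hsize.2 _ _ (cut _ hsize.1 _ _ ?_ ?_) h2
      · exact h1.mono subset_rfl (Set.insert_subset_insert (Set.subset_insert _ _))
      · exact Proves.mono inv (Set.insert_subset_insert hΓ) (Set.insert_subset_insert hΔ)
    · exact .impL h hs h1 h2
  | impR h hs _ ih =>
    exact .impR h hs (ih (insert_subset_insert_insert h₀ _)
      (hΓ.trans (Set.subset_insert _ _)) (hΔ.trans (Set.subset_insert _ _)))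
  | allL h hs hφ _ ih =>
    have h1 := ih (insert_subset_insert_insert h₀ _) (hΓ.trans (Set.subset_insert _ _)) hΔ
    rcases h₀ h with rfl | h
    · rw [hs] at inv
      -- Inversion supplies precisely the instance chosen by the left rule, and the cut moves to it.
      exact cut _ (Proposition.size_all hs hφ) _ _
        ((inv _ hφ).mono hΓ (Set.insert_subset_insert hΔ)) h1
    · exact .allL h hs hφ h1
  | allR h hs _ ih =>
    exact .allR h hs fun φ hφ => ih φ hφ h₀ hΓ (hΔ.trans (Set.subset_insert _ _))

/-- The cut rule is admissible. -/
theorem Proves.cut {Γ Δ : Set (Proposition 𝒮)} {χ : Proposition 𝒮}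
    (h : Proves Γ (insert χ Δ)) (h' : Proves (insert χ Γ) Δ) : Proves Γ Δ := by
  induction hn : χ.size using Nat.strong_induction_on generalizing χ Γ Δ with
  | _ n ih =>
    subst hn
    exact Proves.cut_step (fun φ hφ _ _ h h' => ih _ hφ h h' rfl) h h' subset_rfl subset_rfl
      subset_rfl

/-! ## Translations between the two calculi -/

theorem RawSubst.image_bind_update {Φ : Set (Proposition 𝒮)} {X : Unknown 𝒮} (hX : X ∉ setfV Φ)
    (θ : RawSubst 𝒮) (t : RawTerm 𝒮 X.sort) (ht : t.fa ⊆ X.pmss.carrier) :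
    (Proposition.bind · (θ.update X t ht)) '' Φ = (Proposition.bind · θ) '' Φ :=
  Set.image_congr fun φ hφ => φ.bind_congr fun Z hZ =>
    θ.update_ne (fun e : Z = X => hX (Set.mem_biUnion hφ (e ▸ hZ))) t ht

/-- The statement for all `θ` is what makes the induction work: at the right quantifier rule the
hypothesis is used at `θ` updated at the eigenvariable, once for each permitted term. -/
theorem Derivable.proves {c : Bool} {Φ Ψ : Set (Proposition 𝒮)} (h : Derivable c Φ Ψ)
    (θ : RawSubst 𝒮) :
    Proves ((Proposition.bind · θ) '' Φ) ((Proposition.bind · θ) '' Ψ) := by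
  induction h generalizing θ with
  | ax Φ Ψ φ π =>
    refine .ax (Set.mem_image_of_mem _ (Set.mem_insert _ _))
      (Set.mem_image_of_mem _ (Set.mem_insert _ _)) ⟨π, φ.bind_perm θ π⟩
  | botL Φ Ψ => exact .botL (Set.mem_image_of_mem _ (Set.mem_insert _ _)) rfl
  | impL Φ Ψ φ ψ _ _ h1 h2 =>
    have h1 := h1 θ
    have h2 := h2 θ
    rw [Set.image_insert_eq] at h1 h2 ⊢
    refine .impL (Set.mem_insert _ _) (by rw [φ.imp_bind, Proposition.shape_imp])
      (h1.mono (Set.subset_insert _ _) subset_rfl)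
      (h2.mono (Set.insert_subset_insert (Set.subset_insert _ _)) subset_rfl)
  | impR Φ Ψ φ ψ _ h =>
    have h := h θ
    rw [Set.image_insert_eq, Set.image_insert_eq] at h
    rw [Set.image_insert_eq]
    exact .impR (Set.mem_insert _ _) (by rw [φ.imp_bind, Proposition.shape_imp])
      (h.mono subset_rfl (Set.insert_subset_insert (Set.subset_insert _ _)))
  | allL Φ Ψ X φ t ht _ h =>
    have h := h θ
    induction t using Quotient.inductionOn with
    | h t =>
    replace ht : t.fa ⊆ X.pmss.carrier := ht
    rw [Set.image_insert_eq, φ.subst_single_eq_bind X t ht, φ.bind_update_bind] at h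
    rw [Set.image_insert_eq]
    exact .allL (Set.mem_insert _ _) (Proposition.shape_all_bind X φ θ) ⟨_, _, rfl⟩
      (h.mono (Set.insert_subset_insert (Set.subset_insert _ _)) subset_rfl)
  | allR Φ Ψ X φ hX _ h =>
    rw [Set.image_insert_eq]
    refine .allR (Set.mem_insert _ _) (Proposition.shape_all_bind X φ θ) ?_
    rintro _ ⟨t, ht, rfl⟩
    have h := h (θ.update X t ht)
    rw [setfV, Set.biUnion_union] at hX
    -- The eigenvariable condition: updating at `X` leaves both sides of the context unchanged.
    rw [Set.image_insert_eq, RawSubst.image_bind_update fun h => hX (.inl h),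
      RawSubst.image_bind_update fun h => hX (.inr h)] at h
    exact h.mono subset_rfl (Set.insert_subset_insert (Set.subset_insert _ _))
  | cut Φ Ψ φ _ _ _ h1 h2 =>
    have h1 := h1 θ
    have h2 := h2 θ
    rw [Set.image_insert_eq] at h1 h2
    exact h1.cut h2

/-! ### Back to finitary derivations -/

theorem Proposition.fV_finite (φ : Proposition 𝒮) : φ.fV.Finite := by
  induction φ using Quotient.inductionOn with
  | h φ => exact φ.fV_finite

/-- Going from conclusion to premise adds a proposition, hence finitely many free unknowns, which
cannot exhaust an infinite supply. -/
theorem FreshSupply.of_diff_finite {Γ Δ Γ' Δ' : Set (Proposition 𝒮)} (h : FreshSupply Γ Δ)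
    {F : Set (Unknown 𝒮)} (hF : F.Finite) (hsub : setfV (Γ' ∪ Δ') ⊆ setfV (Γ ∪ Δ) ∪ F) :
    FreshSupply Γ' Δ' := by
  intro α S
  have hinj : Function.Injective fun n : ℕ => (⟨α, S, n⟩ : Unknown 𝒮) :=
    fun a b h => (Unknown.mk.inj h).2.2
  refine ((h α S).sdiff (hF.preimage hinj.injOn)).mono ?_
  rintro n ⟨hn, hnF⟩ hmem
  exact (hsub hmem).elim hn hnF

theorem FreshSupply.insert_left {Γ Δ : Set (Proposition 𝒮)} (h : FreshSupply Γ Δ)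
    (φ : Proposition 𝒮) : FreshSupply (insert φ Γ) Δ :=
  h.of_diff_finite φ.fV_finite (by simp [setfV, Set.union_comm])

theorem FreshSupply.insert_right {Γ Δ : Set (Proposition 𝒮)} (h : FreshSupply Γ Δ)
    (φ : Proposition 𝒮) : FreshSupply Γ (insert φ Δ) :=
  h.of_diff_finite φ.fV_finite (by simp [setfV, Set.union_insert, Set.union_comm])

theorem Proposition.eq_bot {χ : Proposition 𝒮} (h : χ.shape = .bot) : χ = .bot := by
  induction χ using Quotient.inductionOn with
  | h χ =>
  cases χ with
  | bot => rfl
  | _ => cases h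

theorem Proposition.eq_imp {χ φ ψ : Proposition 𝒮} (h : χ.shape = .imp φ ψ) :
    χ = φ.imp ψ := by
  induction χ using Quotient.inductionOn with
  | h χ =>
  cases χ with
  | imp _ _ => cases h; rfl
  | _ => cases h

theorem Proposition.exists_eq_all {χ : Proposition 𝒮} {I : Set (Proposition 𝒮)}
    (h : χ.shape = .all I) :
    ∃ X φ, χ = Proposition.all X φ ∧ I = Proposition.instances X φ RawSubst.id := by
  induction χ using Quotient.inductionOn with
  | h χ =>
  cases χ with
  | all X φ => cases h; exact ⟨X, Quotient.mk _ φ, rfl, rfl⟩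
  | _ => cases h

/-- The instance at a fresh unknown can serve as the body of the same quantified proposition. This
turns one premise of the infinitary rule into the premise of the finitary one. -/
theorem Proposition.all_rename (X : Unknown 𝒮) (φ : Proposition 𝒮) (n : ℕ)
    (hn : (⟨X.sort, X.pmss, n⟩ : Unknown 𝒮) ∉ (Proposition.all X φ).fV) :
    ∃ ψ ∈ Proposition.instances X φ RawSubst.id,
      Proposition.all ⟨X.sort, X.pmss, n⟩ ψ = Proposition.all X φ := by
  refine ⟨_, ⟨.unk 1 X.pmss n, (Set.image_id _).subset, rfl⟩, ?_⟩
  induction φ using Quotient.inductionOn with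
  | h φ => exact Quotient.sound (φ.all_rename X n hn)

theorem Proves.derivable {Φ Ψ : Set (Proposition 𝒮)} (h : Proves Φ Ψ) (c : Bool)
    (hf : FreshSupply Φ Ψ) : Derivable c Φ Ψ := by
  induction h with
  | ax hφ hψ ho =>
    obtain ⟨π, rfl⟩ := ho
    -- Inserting a proposition already present changes nothing; this matches the cumulative rules of
    -- `Proves` with the displayed principal propositions of `Derivable`, here and below.
    rw [← Set.insert_eq_of_mem hφ, ← Set.insert_eq_of_mem hψ]
    exact .ax _ _ _ π
  | botL hχ hs =>
    rw [← Set.insert_eq_of_mem hχ, Proposition.eq_bot hs]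
    exact .botL _ _
  | impL hχ hs _ _ h1 h2 =>
    rw [← Set.insert_eq_of_mem hχ, Proposition.eq_imp hs]
    exact .impL _ _ _ _ (h1 (hf.insert_right _)) (h2 (hf.insert_left _))
  | impR hχ hs _ h =>
    rw [← Set.insert_eq_of_mem hχ, Proposition.eq_imp hs]
    exact .impR _ _ _ _ (h ((hf.insert_left _).insert_right _))
  | allL hχ hs hφ _ h =>
    obtain ⟨X, ψ, rfl, rfl⟩ := Proposition.exists_eq_all hs
    obtain ⟨t, ht, rfl⟩ := hφ
    rw [← Set.insert_eq_of_mem hχ]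
    have h := h (hf.insert_left _)
    rw [← ψ.subst_single_eq_bind X t ht] at h
    exact .allL _ _ X ψ _ _ h
  | @allR Γ Δ χ I hχ hs _ h =>
    obtain ⟨X, φ, rfl, rfl⟩ := Proposition.exists_eq_all hs
    -- Of all premises only the one for a fresh unknown is kept. The unknown must be fresh for the
    -- whole sequent, since the quantified proposition also stays in the context.
    obtain ⟨n, hn⟩ := (hf X.sort X.pmss).nonempty
    obtain ⟨ψ, hψ, e⟩ := φ.all_rename X n
      fun hm => hn (Set.mem_biUnion (Set.mem_union_right _ hχ) hm)
    rw [← Set.insert_eq_of_mem hχ, ← e]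
    exact .allR _ _ _ ψ hn (h ψ hψ (hf.insert_right _))

end PNL

theorem theorem6 (𝒮 : PNL.Signature) (Φ Ψ : Set (PNL.Proposition 𝒮))
    (hfresh : PNL.FreshSupply Φ Ψ) (h : PNL.Derivable true Φ Ψ) :
    PNL.Derivable false Φ Ψ := by
  have h := h.proves PNL.RawSubst.id
  simp only [PNL.Proposition.bind_id, Set.image_id'] at h
  exact h.derivable false hfresh
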